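/- Let $H=L^2([0,1])$ (real), let $p\ge 1$, let $\Psi_1,\dots,\Psi_p:H\to H$ be bounded linear operators, and consider the FAR($p$) model $$Y_k=\Psi_1(Y_{k-1})+\cdots+\Psi_p(Y_{k-p})+\varepsilon_k,\qquad k\in\mathbb Z. \tag{1}$$ Let Assumption FAR hold: $(\varepsilon_k)_{k\in\mathbb Z}$ is an i.i.d. sequence of $H$-valued random variables with $E\|\varepsilon_k\|^2<\infty$ and $E[\varepsilon_k]=0$, and (1) possesses a (a.s.) unique solution with $E\|Y_k\|^2<\infty$ that is strictly stationary and causal (each $Y_k$ is a.s. a measurable function of $\varepsilon_k,\varepsilon_{k-1},\dots$); let $(Y_k)$ be this solution. Let $H_p=H^p$ with inner product $\langle x,y\rangle_p=\sum_{j=1}^p\langle x_j,y_j\rangle$, let $X_k=(Y_k,\dots,Y_{k-p+1})'\in H_p$, and let $$\Psi^*(x_1,\dots,x_p)=\Big(\sum_{j=1}^p\Psi_j(x_j),\,x_1,\dots,x_{p-1}\Big)$$ be the companion operator on $H_p$. Suppose that the operator norm satisfies $\|(\Psi^*)^{k_0}\|<1$ for some $k_0\ge1$. Fix $d\ge 0$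 and $s\in\mathbb Z$, and let $X_s,\dots,X_n$ be the sample, of size $N=n-s+1$ (the case $s=1$ uses $X_1,\dots,X_n$; the case $s=p$ uses only $Y_1,\dots,Y_n$). Let $$\hat C_n(x)=\frac1N\sum_{k=s}^n\langle X_k-m_n,x\rangle_p\,(X_k-m_n),$$ where either $m_n=\frac1N\sum_{k=s}^nX_k$ for all $n$, or $m_n=0$ (the known mean) for all $n$. Let $\hat\lambda_1\ge\cdots\ge\hat\lambda_d$ be the $d$ largest eigenvalues of $\hat C_n$, counted with multiplicity, and $\hat v_1,\dots,\hat v_d$ corresponding orthonormal eigenvectors (in any choice), and let $\boldsymbol X^e_k=(\langle X_k,\hat v_1\rangle_p,\dots,\langle X_k,\hat v_d\rangle_p)'$ be the score vectors. * VAR-based predictor: let $\hat B$ be an ordinary least squares estimate of the VAR(1) coefficient matrix, i.e. a minimizer over $B\in\mathbb R^{d\times d}$ of $\sum_{k=s+1}^n\|\boldsymbol X^e_k-B\boldsymbol X^e_{k-1}\|^2$, and put $\hat X_{n+1}=\sum_{\ell=1}^d(\hat B\boldsymbol X^e_n)_\ell\,\hat v_\ell$. * Bosq's predictor: $$\tilde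 X_{n+1}=\frac1{N-1}\sum_{k=s+1}^n\sum_{\ell=1}^d\sum_{\ell'=1}^d\hat\lambda_\ell^{-1}\langle X_n,\hat v_\ell\rangle_p\langle X_{k-1},\hat v_\ell\rangle_p\langle X_k,\hat v_{\ell'}\rangle_p\,\hat v_{\ell'},$$ where terms with $\hat\lambda_\ell=0$ are omitted. Let $\hat Y_{n+1}=\hat X^{(1)}_{n+1}$ and $\tilde Y_{n+1}=\tilde X^{(1)}_{n+1}$ be the first components of these $H_p$-valued predictors. Then $$\|\hat Y_{n+1}-\tilde Y_{n+1}\|=O_P(1/n)\qquad(n\to\infty),$$ that is, for every $\eta>0$ there are $M$ and $n_0$ such that $P\big(\|\hat Y_{n+1}-\tilde Y_{n+1}\|>M/n\big)\le\eta$ for all $n\ge n_0$. (If the left-hand event is not measurable, $P$ is the outer probability.) -/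

import Mathlib

open MeasureTheory ProbabilityTheory Filter

noncomputable section

namespace FunctionalAR

/-! ### The function space and the state space -/

/-- The real Hilbert space `H = L²([0,1])`. -/
abbrev H : Type := Lp ℝ 2 ((volume : Measure ℝ).restrict (Set.Icc 0 1))

/-- `H` carries its Borel σ-algebra. -/
instance instMeasurableSpaceH : MeasurableSpace H := borel H

instance instBorelSpaceH : BorelSpace H := ⟨rfl⟩

/-- The Hilbert space `H_p = H^p`, with inner product `⟨x, y⟩_p = ∑ j, ⟨x_j, y_j⟩`. -/
abbrev Hp (p : ℕ) : Type := PiLp 2 (fun _ : Fin p => H)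

/-- The companion operator `Ψ*` on `H_p`:
`(x_0, …, x_{p-1}) ↦ (∑ j, Ψ_j x_j, x_0, …, x_{p-2})`.
Coordinates and operators are indexed from `0`, so `Ψ j` is the coefficient at lag `j + 1`. -/
def companion {p : ℕ} (Ψ : Fin p → H →L[ℝ] H) : Hp p →L[ℝ] Hp p :=
  ((PiLp.continuousLinearEquiv 2 ℝ (fun _ : Fin p => H)).symm :
      (Fin p → H) →L[ℝ] Hp p).comp
    (ContinuousLinearMap.pi fun i : Fin p =>
      if i.val = 0 then
        ∑ j : Fin p, (Ψ j).comp (PiLp.proj 2 (fun _ : Fin p => H) j)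
      else
        PiLp.proj 2 (fun _ : Fin p => H)
          ⟨i.val - 1, lt_of_le_of_lt (Nat.sub_le i.val 1) i.isLt⟩)

/-- The state vector `X_k = (Y_k, Y_{k-1}, …, Y_{k-p+1})`. -/
def stateVector (p : ℕ) (y : ℤ → H) (k : ℤ) : Hp p :=
  WithLp.toLp 2 (fun j : Fin p => y (k - (j.val : ℤ)))

/-! ### The functional autoregressive model -/

section Model

variable {Ω : Type*} [MeasurableSpace Ω]

/-- The innovations are i.i.d., centred, and in `L²_H`. -/
structure IsInnovation (P : Measure Ω) (ε : ℤ → Ω → H) : Prop where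
  measurable : ∀ k, Measurable (ε k)
  indep : iIndepFun ε P
  identDistrib : ∀ k, IdentDistrib (ε k) (ε 0) P P
  memLp : ∀ k, MemLp (ε k) 2 P
  centred : ∀ k, ∫ ω, ε k ω ∂P = 0

/-- `Y` is a (strictly) stationary and causal solution in `L²_H` of
`Y_k = Ψ_1 Y_{k-1} + ⋯ + Ψ_p Y_{k-p} + ε_k`, `k ∈ ℤ`.
Causal: each `Y_k` is almost surely a measurable function of `ε_k, ε_{k-1}, …`. -/
structure IsStationaryCausalSolution {p : ℕ} (P : Measure Ω) (Ψ : Fin p → H →L[ℝ] H)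
    (ε Y : ℤ → Ω → H) : Prop where
  measurable : ∀ k, Measurable (Y k)
  memLp : ∀ k, MemLp (Y k) 2 P
  recursion : ∀ k, ∀ᵐ ω ∂P,
    Y k ω = ∑ j : Fin p, Ψ j (Y (k - ((j.val : ℤ) + 1)) ω) + ε k ω
  stationary : ∀ h : ℤ,
    IdentDistrib (fun ω (k : ℤ) => Y (k + h) ω) (fun ω (k : ℤ) => Y k ω) P P
  causal : ∀ k, ∃ g : (ℕ → H) → H, Measurable g ∧
    ∀ᵐ ω ∂P, Y k ω = g (fun i => ε (k - (i : ℤ)) ω)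

/-- Assumption FAR: the innovations are i.i.d., centred and in `L²_H`, and the autoregressive
equation has an (almost surely) unique stationary and causal solution. -/
structure AssumptionFAR {p : ℕ} (P : Measure Ω) (Ψ : Fin p → H →L[ℝ] H)
    (ε : ℤ → Ω → H) : Prop where
  innovation : IsInnovation P ε
  exists_solution : ∃ Y : ℤ → Ω → H, IsStationaryCausalSolution P Ψ ε Y
  unique_solution : ∀ Y Y' : ℤ → Ω → H, IsStationaryCausalSolution P Ψ ε Y →
    IsStationaryCausalSolution P Ψ ε Y' → ∀ k, Y k =ᵐ[P] Y' k

/-- `Z_n = O_P(a_n)` as `n → ∞`: for every `η > 0` there is an `M` with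
`P(|Z_n| > M a_n) ≤ η` for all large `n`. (`P` of a non-measurable set is its outer measure.) -/
def IsBigOP (P : Measure Ω) (Z : ℕ → Ω → ℝ) (a : ℕ → ℝ) : Prop :=
  ∀ η : ℝ, 0 < η → ∃ M : ℝ, ∀ᶠ n : ℕ in atTop,
    P {ω | M * a n < |Z n ω|} ≤ ENNReal.ofReal η

end Model

/-! ### Sample quantities and predictors

All of them are computed from observations `x_a, x_{a+1}, …, x_b` in a real Hilbert space. -/

section Sample

variable {E : Type*} [NormedAddCommGroup E] [InnerProductSpace ℝ E]

/-- The sample mean of `x_a, …, x_b`. -/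
def sampleMean (x : ℤ → E) (a b : ℤ) : E :=
  ((b - a + 1 : ℤ) : ℝ)⁻¹ • ∑ k ∈ Finset.Icc a b, x k

/-- The sample covariance operator with centring `m`:
`z ↦ (b-a+1)⁻¹ ∑_{k=a}^b ⟨x_k - m, z⟩ (x_k - m)`. -/
def sampleCov (m : E) (x : ℤ → E) (a b : ℤ) : E →L[ℝ] E :=
  ((b - a + 1 : ℤ) : ℝ)⁻¹ •
    ∑ k ∈ Finset.Icc a b, (innerSL ℝ (x k - m)).smulRight (x k - m)

/-- `lam 0 ≥ ⋯ ≥ lam (d-1)` are the `d` largest eigenvalues (with multiplicity) of the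
compact self-adjoint operator `T`, and `v 0, …, v (d-1)` are corresponding orthonormal
eigenvectors. The last field says that the quadratic form of `T` on the orthogonal complement
of the `v i` (that is, every remaining eigenvalue) is bounded by each `lam i`. -/
structure IsLeadingEigensystem (T : E →L[ℝ] E) {d : ℕ} (lam : Fin d → ℝ)
    (v : Fin d → E) : Prop where
  orthonormal : Orthonormal ℝ v
  eigen : ∀ i, T (v i) = lam i • v i
  antitone : Antitone lam
  leading : ∀ i z, (∀ j, inner ℝ (v j) z = 0) → inner ℝ (T z) z ≤ lam i * ‖z‖ ^ 2

/-- The score vector `(⟨z, v_1⟩, …, ⟨z, v_d⟩)`. -/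
def score {d : ℕ} (v : Fin d → E) (z : E) : Fin d → ℝ := fun i => inner ℝ z (v i)

/-- The residual sum of squares `∑_{k=a+1}^b ‖y_k - B y_{k-1}‖²` of the VAR(1) model with
coefficient matrix `B` for the score vectors `y_k` of `x_a, …, x_b`. -/
def varRSS {d : ℕ} (v : Fin d → E) (x : ℤ → E) (a b : ℤ)
    (B : Matrix (Fin d) (Fin d) ℝ) : ℝ :=
  ∑ k ∈ Finset.Icc (a + 1) b,
    ∑ i : Fin d, (score v (x k) i - (B.mulVec (score v (x (k - 1)))) i) ^ 2

/-- `B` is an ordinary least squares estimate of the VAR(1) coefficient matrix. -/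
def IsOLS {d : ℕ} (v : Fin d → E) (x : ℤ → E) (a b : ℤ)
    (B : Matrix (Fin d) (Fin d) ℝ) : Prop :=
  ∀ B' : Matrix (Fin d) (Fin d) ℝ, varRSS v x a b B ≤ varRSS v x a b B'

/-- The VAR(1)-based predictor of `x_{b+1}`: the predicted score vector `B y_b`, transformed
back by the truncated Karhunen-Loève expansion. -/
def varPredictor {d : ℕ} (v : Fin d → E) (x : ℤ → E) (b : ℤ)
    (B : Matrix (Fin d) (Fin d) ℝ) : E :=
  ∑ i : Fin d, (B.mulVec (score v (x b))) i • v i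

/-- Bosq's estimator of the autoregressive operator, applied to `z`. A component with
`lam i = 0` contributes nothing, since `0⁻¹ = 0`. -/
def bosqOperator {d : ℕ} (lam : Fin d → ℝ) (v : Fin d → E) (x : ℤ → E) (a b : ℤ)
    (z : E) : E :=
  ((b - a : ℤ) : ℝ)⁻¹ • ∑ k ∈ Finset.Icc (a + 1) b, ∑ i : Fin d, ∑ j : Fin d,
    ((lam i)⁻¹ * inner ℝ z (v i) * inner ℝ (x (k - 1)) (v i) * inner ℝ (x k) (v j)) • v j

/-- Bosq's predictor of `x_{b+1}`. -/
def bosqPredictor {d : ℕ} (lam : Fin d → ℝ) (v : Fin d → E) (x : ℤ → E) (a b : ℤ) : E :=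
  bosqOperator lam v x a b (x b)

end Sample

end FunctionalAR

end

open FunctionalAR

open MeasureTheory ProbabilityTheory Filter

noncomputable section

namespace FunctionalAR

/-! ### Comparison of the two regressions for fixed data. -/

section Deterministic

variable {E : Type*} [NormedAddCommGroup E] [InnerProductSpace ℝ E]

/-! In score coordinates the least squares matrix solves `B G = C`, where `G` and `C` are the
lag-zero and lag-one moment matrices of the scores. Bosq's operator is `C` applied to the inverse of
the diagonal matrix of empirical eigenvalues, as if `G` were that matrix. By the eigenvector
equations, `G` divided by `N - 1` differs from it only through the normalisation, the missing last
observation and the centring term `m_n`. Each of these is `O_P(1/n)`: `‖X_n‖²` is bounded in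
probability by stationarity, and `N ‖m_n‖²` because partial sums have second moments of order `N`
(`exists_integral_norm_sum_sq_le`). Hence the predictors differ by `O_P(1/n)` once the eigenvalues
that matter stay away from zero. Neither consistency of the eigenvectors nor a spectral gap is
needed. `norm_regression_sub_le` and `norm_varPredictor_sub_bosqPredictor_le` make this
deterministic.

For the eigenvalue bound, choose up to `d` directions in which the scores of `X_0` are uncorrelated
with unit second moment (`exists_orthonormal_momentForm`). If only `r < d` exist, then `X_0` lies
almost surely in a fixed space of dimension at most `r`. A law of large numbers for these finitely
many cross moments (`tendsto_crossMoment`) and a min-max argument (`IsLeadingEigensystem.le_card`)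
give `r` eigenvalues above a fixed constant. Any other eigenvector is orthogonal to all the data, so
both predictors ignore it. The law of large numbers comes from `m`-dependent moving averages, since
the powers of the companion operator tend to zero along multiples of `k₀`.

Everything takes place in a general Hilbert space. The theorem follows by stacking the lags and
bounding the first coordinate by the full norm. -/

/-- The normal equations of the least squares problem. -/
theorem IsOLS.normal_eq {d : ℕ} {v : Fin d → E} {x : ℤ → E} {a b : ℤ}
    {B : Matrix (Fin d) (Fin d) ℝ} (hB : IsOLS v x a b B) (i j : Fin d) :
    ∑ k ∈ Finset.Icc (a + 1) b, (score v (x k) i - (B.mulVec (score v (x (k - 1)))) i)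
      * score v (x (k - 1)) j = 0 := by
  set S := ∑ k ∈ Finset.Icc (a + 1) b, (score v (x k) i - (B.mulVec (score v (x (k - 1)))) i)
      * score v (x (k - 1)) j with hS
  set Q := ∑ k ∈ Finset.Icc (a + 1) b, (score v (x (k - 1)) j) ^ 2 with hQ
  have key : ∀ t : ℝ, varRSS v x a b (B + Matrix.single i j t)
      = varRSS v x a b B - 2 * t * S + t ^ 2 * Q := by
    intro t
    simp only [varRSS, hS, hQ, Finset.mul_sum, ← Finset.sum_sub_distrib, ← Finset.sum_add_distrib]
    refine Finset.sum_congr rfl fun k _ => ?_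
    rw [← Finset.add_sum_erase _ _ (Finset.mem_univ i),
      ← Finset.add_sum_erase (a := i) (f := fun i => (score v (x k) i
        - (B.mulVec (score v (x (k - 1)))) i) ^ 2) _ (Finset.mem_univ i)]
    have h1 : ∀ l ∈ Finset.univ.erase i,
        (score v (x k) l - ((B + Matrix.single i j t).mulVec (score v (x (k - 1)))) l) ^ 2
        = (score v (x k) l - (B.mulVec (score v (x (k - 1)))) l) ^ 2 := by
      intro l hl
      have : l ≠ i := Finset.ne_of_mem_erase hl
      simp [Matrix.add_mulVec, Matrix.single_mulVec, this]
    rw [Finset.sum_congr rfl h1]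
    simp only [Matrix.add_mulVec, Matrix.single_mulVec, Pi.add_apply, Function.update_self]
    ring
  have h2 : ∀ t : ℝ, 0 ≤ - 2 * t * S + t ^ 2 * Q := by
    intro t
    have := hB (B + Matrix.single i j t)
    rw [key] at this
    linarith
  have hQ0 : 0 ≤ Q := Finset.sum_nonneg fun _ _ => sq_nonneg _
  -- The quadratic in `t` is nonnegative everywhere and vanishes at zero, so its slope must be zero.
  -- The denominator `Q + 1` avoids a separate case for `Q = 0`.
  have h3 := h2 (S / (Q + 1))
  have h4 : -2 * (S / (Q + 1)) * S + (S / (Q + 1)) ^ 2 * Q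
      = - (S ^ 2 * (Q + 2)) / (Q + 1) ^ 2 := by
    field_simp
    ring
  rw [h4, neg_div, Left.nonneg_neg_iff] at h3
  have h5 : S ^ 2 * (Q + 2) ≤ 0 := by
    by_contra h
    exact absurd h3 (not_le.2 (div_pos (not_le.1 h) (by positivity)))
  have h6 : S ^ 2 ≤ 0 := by nlinarith [sq_nonneg S]
  exact pow_eq_zero_iff (two_ne_zero) |>.1 (le_antisymm h6 (sq_nonneg _))

/-- Splitting off the last term of a sum over an integer interval, after a shift. -/
theorem sum_Icc_shift {G : Type*} [AddCommGroup G] (f : ℤ → G) {a b : ℤ} (hab : a ≤ b) :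
    ∑ k ∈ Finset.Icc (a + 1) b, f (k - 1) = ∑ k ∈ Finset.Icc a b, f k - f b := by
  have h : ∑ k ∈ Finset.Icc (a + 1) b, f (k - 1) = ∑ k ∈ Finset.Ico a b, f k := by
    refine Finset.sum_bij' (fun k _ => k - 1) (fun k _ => k + 1) ?_ ?_ ?_ ?_ ?_
    · intro k hk; simp only [Finset.mem_Icc, Finset.mem_Ico] at *; omega
    · intro k hk; simp only [Finset.mem_Icc, Finset.mem_Ico] at *; omega
    · intro k _; simp
    · intro k _; simp
    · intro k _; rfl
  rw [h, ← Finset.Ico_insert_right hab, Finset.sum_insert (by simp)]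
  abel

theorem sum_norm_mul_norm_le {F : Type*} [NormedAddCommGroup F] (y : ℤ → F) {a b : ℤ}
    (hab : a ≤ b) :
    ∑ k ∈ Finset.Icc (a + 1) b, ‖y (k - 1)‖ * ‖y k‖ ≤ ∑ k ∈ Finset.Icc a b, ‖y k‖ ^ 2 := by
  have h1 := sum_Icc_shift (fun k => ‖y k‖ ^ 2) hab
  have h2 : ∑ k ∈ Finset.Icc (a + 1) b, ‖y k‖ ^ 2 ≤ ∑ k ∈ Finset.Icc a b, ‖y k‖ ^ 2 :=
    Finset.sum_le_sum_of_subset_of_nonneg (Finset.Icc_subset_Icc_left (by omega))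
      fun _ _ _ => sq_nonneg _
  have h3 : ∑ k ∈ Finset.Icc (a + 1) b, ‖y (k - 1)‖ * ‖y k‖
      ≤ ∑ k ∈ Finset.Icc (a + 1) b, (‖y (k - 1)‖ ^ 2 / 2 + ‖y k‖ ^ 2 / 2) :=
    Finset.sum_le_sum fun k _ => by nlinarith [sq_nonneg (‖y (k - 1)‖ - ‖y k‖)]
  rw [Finset.sum_add_distrib, ← Finset.sum_div, ← Finset.sum_div] at h3
  nlinarith [sq_nonneg ‖y b‖]

/-- Comparison of the exact and the approximate solution of a system of normal equations: the
regression `β` of `y_k` on `y_{k-1}` and its approximation in which the Gram operator is replaced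
by the inverse covariance `Lp`. -/
theorem norm_regression_sub_le {F : Type*} [NormedAddCommGroup F] [InnerProductSpace ℝ F]
    (y : ℤ → F) {a b : ℤ} (β Q : F →L[ℝ] F) (Lp : F → F) (μ : F) {c M : ℝ} (hc : 0 < c)
    (hM : 0 ≤ M) (hab : a + 1 ≤ b)
    (hnormal : ∀ w, β (∑ k ∈ Finset.Icc (a + 1) b, inner ℝ (y (k - 1)) w • y (k - 1))
      = ∑ k ∈ Finset.Icc (a + 1) b, inner ℝ (y (k - 1)) w • y k)
    (hcov : ∀ u, ∑ k ∈ Finset.Icc a b, inner ℝ (y k) (Lp u) • y k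
      = ((b - a + 1 : ℤ) : ℝ) • (Q u + inner ℝ μ (Lp u) • μ))
    (hLp : ∀ u, ‖Lp u‖ ≤ c⁻¹ * ‖u‖) (hQ : ∀ u, ‖Q u‖ ≤ ‖u‖) (hQQ : ∀ u, Q (Q u) = Q u)
    (hQy : Q (y b) = y b) (hQμ : Q μ = μ)
    (hμ : ((b - a + 1 : ℤ) : ℝ) * ‖μ‖ ^ 2 ≤ M) (hyb : ‖y b‖ ^ 2 ≤ M)
    (hy : ∑ k ∈ Finset.Icc a b, ‖y k‖ ^ 2 ≤ ((b - a + 1 : ℤ) : ℝ) * M)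
    (hN : 2 * (1 + 2 * M * c⁻¹) ≤ ((b - a : ℤ) : ℝ)) :
    ‖β (y b) - ((b - a : ℤ) : ℝ)⁻¹ •
        ∑ k ∈ Finset.Icc (a + 1) b, inner ℝ (y (k - 1)) (Lp (y b)) • y k‖
      ≤ (4 * M * c⁻¹) * ((1 + 2 * M * c⁻¹) * √M) / ((b - a : ℤ) : ℝ) := by
  set n : ℝ := ((b - a : ℤ) : ℝ) with hn
  have hN1 : ((b - a + 1 : ℤ) : ℝ) = n + 1 := by rw [hn]; push_cast; ring
  rw [hN1] at hcov hμ hy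
  have hc' : 0 < c⁻¹ := inv_pos.2 hc
  have hn1 : 1 ≤ n := by rw [hn]; exact_mod_cast (by omega : (1 : ℤ) ≤ b - a)
  have hn0 : 0 < n := by linarith
  set K := 1 + 2 * M * c⁻¹ with hK
  have hK0 : 0 ≤ K := by positivity
  -- Least squares does not determine `β` off the range of the Gram operator, so only its
  -- restriction to the range of `Q` can be bounded.
  let γ : F →L[ℝ] F := β.comp Q
  let D : F → F := fun u => n⁻¹ • ∑ k ∈ Finset.Icc (a + 1) b, inner ℝ (y (k - 1)) (Lp u) • y k
  -- The error of `Lp` as an inverse: the Gram operator over `n`, applied to `Lp u`, is `Q u + T u`.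
  -- The three terms come from the factor `(n + 1) / n`, the centring and the last observation.
  let T : F → F := fun u =>
    n⁻¹ • (Q u + (n + 1) • inner ℝ μ (Lp u) • μ - inner ℝ (y b) (Lp u) • y b)
  have hQT : ∀ u, Q (T u) = T u := by
    intro u
    simp only [T, map_smul, map_sub, map_add, hQQ, hQμ, hQy]
  have hD : ∀ u, D u = γ u + γ (T u) := by
    intro u
    have h1 : γ u + γ (T u) = β (Q u + T u) := by
      simp only [γ, ContinuousLinearMap.comp_apply, hQT, map_add]
    rw [h1]
    simp only [D]
    rw [← hnormal, ← map_smul]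
    congr 1
    rw [sum_Icc_shift (fun k => inner ℝ (y k) (Lp u) • y k) (by omega), hcov]
    simp only [T]
    rw [← sub_eq_zero]
    have : n⁻¹ * n = 1 := inv_mul_cancel₀ hn0.ne'
    have h2 : Q u = (n⁻¹ * n) • Q u := by rw [this, one_smul]
    nth_rewrite 2 [h2]
    module
  have hT : ∀ u, ‖T u‖ ≤ K / n * ‖u‖ := by
    intro u
    have h1 : ‖(n + 1) • inner ℝ μ (Lp u) • μ‖ ≤ M * c⁻¹ * ‖u‖ := by
      rw [norm_smul, norm_smul, Real.norm_of_nonneg (by positivity : 0 ≤ n + 1)]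
      calc (n + 1) * (‖inner ℝ μ (Lp u)‖ * ‖μ‖) ≤ (n + 1) * ((‖μ‖ * (c⁻¹ * ‖u‖)) * ‖μ‖) := by
            gcongr
            exact (norm_inner_le_norm _ _).trans (by gcongr; exact hLp u)
        _ = ((n + 1) * ‖μ‖ ^ 2) * (c⁻¹ * ‖u‖) := by ring
        _ ≤ M * (c⁻¹ * ‖u‖) := by gcongr
        _ = _ := by ring
    have h2 : ‖inner ℝ (y b) (Lp u) • y b‖ ≤ M * c⁻¹ * ‖u‖ := by
      rw [norm_smul]
      calc ‖inner ℝ (y b) (Lp u)‖ * ‖y b‖ ≤ (‖y b‖ * (c⁻¹ * ‖u‖)) * ‖y b‖ := by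
            gcongr
            exact (norm_inner_le_norm _ _).trans (by gcongr; exact hLp u)
        _ = ‖y b‖ ^ 2 * (c⁻¹ * ‖u‖) := by ring
        _ ≤ M * (c⁻¹ * ‖u‖) := by gcongr
        _ = _ := by ring
    simp only [T]
    rw [norm_smul, Real.norm_of_nonneg (by positivity)]
    have h3 := norm_sub_le (Q u + (n + 1) • inner ℝ μ (Lp u) • μ) (inner ℝ (y b) (Lp u) • y b)
    have h4 := norm_add_le (Q u) ((n + 1) • inner ℝ μ (Lp u) • μ)
    have h5 : ‖Q u + (n + 1) • inner ℝ μ (Lp u) • μ - inner ℝ (y b) (Lp u) • y b‖ ≤ K * ‖u‖ := by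
      have := hQ u
      rw [hK]; linarith
    calc _ ≤ n⁻¹ * (K * ‖u‖) := by gcongr
      _ = _ := by ring
  have hDb : ∀ u, ‖D u‖ ≤ 2 * M * c⁻¹ * ‖u‖ := by
    intro u
    simp only [D]
    rw [norm_smul, Real.norm_of_nonneg (by positivity)]
    have h1 : ‖∑ k ∈ Finset.Icc (a + 1) b, inner ℝ (y (k - 1)) (Lp u) • y k‖
        ≤ ((n + 1) * M) * (c⁻¹ * ‖u‖) := by
      refine (norm_sum_le _ _).trans ?_
      calc _ ≤ ∑ k ∈ Finset.Icc (a + 1) b, (‖y (k - 1)‖ * ‖y k‖) * (c⁻¹ * ‖u‖) := by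
            refine Finset.sum_le_sum fun k _ => ?_
            rw [norm_smul]
            calc _ ≤ (‖y (k - 1)‖ * (c⁻¹ * ‖u‖)) * ‖y k‖ := by
                  gcongr
                  exact (norm_inner_le_norm _ _).trans (by gcongr; exact hLp u)
              _ = _ := by ring
        _ ≤ _ := by
            rw [← Finset.sum_mul]
            gcongr
            exact (sum_norm_mul_norm_le y (by omega)).trans hy
    calc _ ≤ n⁻¹ * (((n + 1) * M) * (c⁻¹ * ‖u‖)) := by gcongr
      _ ≤ n⁻¹ * (((2 * n) * M) * (c⁻¹ * ‖u‖)) := by gcongr; linarith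
      _ = (n⁻¹ * n) * (2 * M * c⁻¹ * ‖u‖) := by ring
      _ = _ := by rw [inv_mul_cancel₀ hn0.ne', one_mul]
  have hKn : K / n ≤ 1 / 2 := by
    rw [div_le_div_iff₀ hn0 two_pos]; linarith
  -- Since `T` has norm at most one half, the identity `D = γ + γ T` lets half of `‖γ‖` be absorbed
  -- on the left.
  have hγ : ‖γ‖ ≤ 4 * M * c⁻¹ := by
    have h1 : ‖γ‖ ≤ 2 * M * c⁻¹ + ‖γ‖ * (1 / 2) := by
      refine γ.opNorm_le_bound (by positivity) fun u => ?_
      have h2 : γ u = D u - γ (T u) := by rw [hD]; abel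
      rw [h2]
      calc _ ≤ ‖D u‖ + ‖γ (T u)‖ := norm_sub_le _ _
        _ ≤ 2 * M * c⁻¹ * ‖u‖ + ‖γ‖ * (1 / 2 * ‖u‖) := by
            gcongr
            · exact hDb u
            · refine (γ.le_opNorm _).trans ?_
              gcongr
              exact (hT u).trans (by gcongr)
        _ = _ := by ring
    linarith
  have hfin : β (y b) - D (y b) = - γ (T (y b)) := by
    rw [hD]
    simp only [γ, ContinuousLinearMap.comp_apply, hQy]
    abel
  change ‖β (y b) - D (y b)‖ ≤ _
  rw [hfin, norm_neg]
  have hsq : ‖y b‖ ≤ √M := Real.le_sqrt_of_sq_le hyb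
  calc _ ≤ ‖γ‖ * ‖T (y b)‖ := γ.le_opNorm _
    _ ≤ (4 * M * c⁻¹) * (K / n * √M) := by
        gcongr
        exact (hT _).trans (by gcongr)
    _ = _ := by ring

/-- The quadratic form of the sample covariance operator, for both centrings. -/
theorem inner_sampleCov {m : E} {x : ℤ → E} {a b : ℤ} (hab : a ≤ b)
    (hm : m = 0 ∨ m = sampleMean x a b) (e f : E) :
    inner ℝ (sampleCov m x a b e) f
      = ((b - a + 1 : ℤ) : ℝ)⁻¹ * (∑ k ∈ Finset.Icc a b, inner ℝ (x k) e * inner ℝ (x k) f)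
        - inner ℝ m e * inner ℝ m f := by
  set N : ℝ := ((b - a + 1 : ℤ) : ℝ) with hN
  have hN0 : N ≠ 0 := by
    have : (1 : ℝ) ≤ N := by rw [hN]; exact_mod_cast (by omega : (1 : ℤ) ≤ b - a + 1)
    positivity
  have hcard : ((Finset.Icc a b).card : ℝ) = N := by
    rw [Int.card_Icc, hN]
    have : ((b + 1 - a).toNat : ℤ) = b - a + 1 := by omega
    exact_mod_cast this
  have h0 : inner ℝ (sampleCov m x a b e) f
      = N⁻¹ * ∑ k ∈ Finset.Icc a b, inner ℝ (x k - m) e * inner ℝ (x k - m) f := by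
    simp only [sampleCov, smul_apply, sum_apply,
      ContinuousLinearMap.smulRight_apply, innerSL_apply_apply, inner_smul_left, sum_inner]
    rfl
  rw [h0]
  rcases hm with hm | hm
  · simp [hm]
  · have hs : ∑ k ∈ Finset.Icc a b, x k = N • m := by
      rw [hm, sampleMean, smul_smul, ← hN, mul_inv_cancel₀ hN0, one_smul]
    have he : ∀ g, ∑ k ∈ Finset.Icc a b, inner ℝ (x k) g = N * inner ℝ m g := by
      intro g
      rw [← sum_inner, hs, inner_smul_left]; rfl
    simp only [inner_sub_left, sub_mul, mul_sub, Finset.sum_sub_distrib, ← Finset.sum_mul,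
      ← Finset.mul_sum, he, Finset.sum_const, nsmul_eq_mul, hcard]
    field_simp
    ring

theorem norm_toLp_score_le {d : ℕ} {v : Fin d → E} (hv : Orthonormal ℝ v) (z : E) :
    ‖WithLp.toLp 2 (score v z)‖ ^ 2 ≤ ‖z‖ ^ 2 := by
  rw [EuclideanSpace.norm_sq_eq]
  refine le_trans (le_of_eq ?_) (hv.sum_inner_products_le z (s := Finset.univ))
  refine Finset.sum_congr rfl fun i _ => ?_
  simp [score, real_inner_comm]

theorem norm_sum_smul_of_orthonormal {d : ℕ} {v : Fin d → E} (hv : Orthonormal ℝ v)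
    (z : EuclideanSpace ℝ (Fin d)) : ‖∑ i, z i • v i‖ = ‖z‖ := by
  have h : ‖∑ i, z i • v i‖ ^ 2 = ‖z‖ ^ 2 := by
    rw [EuclideanSpace.norm_sq_eq, ← real_inner_self_eq_norm_sq, hv.inner_sum]
    refine Finset.sum_congr rfl fun i _ => ?_
    simp [sq]
  exact (sq_eq_sq₀ (norm_nonneg _) (norm_nonneg _)).1 h

end Deterministic

/-! ### The two predictors in score coordinates. -/

section Predictors

variable {E : Type*} [NormedAddCommGroup E] [InnerProductSpace ℝ E]

/-- The orthogonal projection of `ℝ^d` onto the coordinates in `J`, scaled by `l`. -/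
def coordScale {d : ℕ} (J : Finset (Fin d)) (l : Fin d → ℝ) :
    EuclideanSpace ℝ (Fin d) →L[ℝ] EuclideanSpace ℝ (Fin d) :=
  Matrix.toEuclideanCLM (𝕜 := ℝ) (Matrix.diagonal fun i => if i ∈ J then l i else 0)

theorem coordScale_apply {d : ℕ} (J : Finset (Fin d)) (l : Fin d → ℝ)
    (u : EuclideanSpace ℝ (Fin d)) (i : Fin d) :
    coordScale J l u i = if i ∈ J then l i * u i else 0 := by
  simp [coordScale, Matrix.ofLp_toEuclideanCLM, Matrix.mulVec_diagonal]

theorem norm_coordScale_le {d : ℕ} (J : Finset (Fin d)) (l : Fin d → ℝ) {C : ℝ} (hC : 0 ≤ C)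
    (hl : ∀ i ∈ J, |l i| ≤ C) (u : EuclideanSpace ℝ (Fin d)) :
    ‖coordScale J l u‖ ≤ C * ‖u‖ := by
  refine (sq_le_sq₀ (norm_nonneg _) (by positivity)).1 ?_
  rw [mul_pow, EuclideanSpace.norm_sq_eq, EuclideanSpace.norm_sq_eq, Finset.mul_sum]
  refine Finset.sum_le_sum fun i _ => ?_
  rw [coordScale_apply]
  split_ifs with h
  · rw [norm_mul, mul_pow, Real.norm_eq_abs]
    gcongr
    exact hl i h
  · simpa using by positivity

/-- If each empirical eigenvalue is at least `c`, or belongs to a direction in which all the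
observations vanish, then the least squares predictor and Bosq's predictor differ by a multiple
of `1 / (b - a)`. -/
theorem norm_varPredictor_sub_bosqPredictor_le {d : ℕ} {x : ℤ → E} {a b : ℤ} {m : E}
    {lam : Fin d → ℝ} {v : Fin d → E} {B : Matrix (Fin d) (Fin d) ℝ} {c M : ℝ}
    (hc : 0 < c) (hM : 0 ≤ M) (hab : a + 1 ≤ b)
    (hm : m = 0 ∨ m = sampleMean x a b)
    (hv : IsLeadingEigensystem (sampleCov m x a b) lam v) (hB : IsOLS v x a b B)
    (hlam : ∀ i, c ≤ lam i ∨ ∀ k ∈ Finset.Icc a b, inner ℝ (x k) (v i) = 0)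
    (hmM : ((b - a + 1 : ℤ) : ℝ) * ‖m‖ ^ 2 ≤ M) (hxb : ‖x b‖ ^ 2 ≤ M)
    (hx : ∑ k ∈ Finset.Icc a b, ‖x k‖ ^ 2 ≤ ((b - a + 1 : ℤ) : ℝ) * M)
    (hN : 2 * (1 + 2 * M * c⁻¹) ≤ ((b - a : ℤ) : ℝ)) :
    ‖varPredictor v x b B - bosqPredictor lam v x a b‖
      ≤ (4 * M * c⁻¹) * ((1 + 2 * M * c⁻¹) * √M) / ((b - a : ℤ) : ℝ) := by
  classical
  let J : Finset (Fin d) := Finset.univ.filter fun i => c ≤ lam i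
  have hJ : ∀ i, i ∈ J ↔ c ≤ lam i := fun i => by simp [J]
  have hJ0 : ∀ i, i ∉ J → ∀ k ∈ Finset.Icc a b, inner ℝ (x k) (v i) = 0 := fun i hi =>
    (hlam i).resolve_left fun h => hi ((hJ i).2 h)
  have hm0 : ∀ i, i ∉ J → inner ℝ m (v i) = 0 := by
    intro i hi
    rcases hm with hm | hm
    · simp [hm]
    · rw [hm, sampleMean, inner_smul_left, sum_inner, Finset.sum_eq_zero (hJ0 i hi), mul_zero]
  let y : ℤ → EuclideanSpace ℝ (Fin d) := fun k => WithLp.toLp 2 (score v (x k))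
  let μ : EuclideanSpace ℝ (Fin d) := WithLp.toLp 2 (score v m)
  let Q := coordScale J fun _ => 1
  -- A truncated inverse of the diagonal covariance. The directions outside `J` carry no data, so
  -- truncation changes neither predictor.
  let R := coordScale J fun i => (lam i)⁻¹
  let β := Matrix.toEuclideanCLM (𝕜 := ℝ) B
  have hN0 : ((b - a + 1 : ℤ) : ℝ) ≠ 0 := by
    exact_mod_cast (by omega : b - a + 1 ≠ 0)
  have hyi : ∀ k i, y k i = inner ℝ (x k) (v i) := fun _ _ => rfl
  have hμi : ∀ i, μ i = inner ℝ m (v i) := fun _ => rfl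
  have hcoord : ∀ i j, ∑ k ∈ Finset.Icc a b, y k i * y k j
      = ((b - a + 1 : ℤ) : ℝ) * ((if i = j then lam i else 0) + μ i * μ j) := by
    intro i j
    have h1 := inner_sampleCov (x := x) (by omega : a ≤ b) hm (v i) (v j)
    rw [hv.eigen, inner_smul_left, orthonormal_iff_ite.1 hv.orthonormal] at h1
    simp only [hyi, hμi]
    have h2 : ∑ k ∈ Finset.Icc a b, inner ℝ (x k) (v i) * inner ℝ (x k) (v j)
        = ((b - a + 1 : ℤ) : ℝ) * (((b - a + 1 : ℤ) : ℝ)⁻¹ *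
          ∑ k ∈ Finset.Icc a b, inner ℝ (x k) (v i) * inner ℝ (x k) (v j)) := by
      rw [← mul_assoc, mul_inv_cancel₀ hN0, one_mul]
    rw [h2, eq_add_of_sub_eq h1.symm]
    congr 2
    split_ifs <;> simp
  have hnormal : ∀ w, β (∑ k ∈ Finset.Icc (a + 1) b, inner ℝ (y (k - 1)) w • y (k - 1))
      = ∑ k ∈ Finset.Icc (a + 1) b, inner ℝ (y (k - 1)) w • y k := by
    intro w
    rw [map_sum, ← sub_eq_zero, ← Finset.sum_sub_distrib]
    ext i
    have h1 : ∀ j, ∑ k ∈ Finset.Icc (a + 1) b, (y k i - β (y (k - 1)) i) * y (k - 1) j = 0 :=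
      fun j => hB.normal_eq i j
    have h2 : ∀ k, (β (inner ℝ (y (k - 1)) w • y (k - 1)) - inner ℝ (y (k - 1)) w • y k) i
        = - ∑ j, w j * ((y k i - β (y (k - 1)) i) * y (k - 1) j) := by
      intro k
      have : inner ℝ (y (k - 1)) w = ∑ j, w j * y (k - 1) j := by
        simp [PiLp.inner_apply]
      simp only [map_smul, PiLp.sub_apply, PiLp.smul_apply, smul_eq_mul, this, Finset.sum_mul,
        ← Finset.sum_sub_distrib, ← Finset.sum_neg_distrib]
      refine Finset.sum_congr rfl fun j _ => ?_
      ring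
    rw [WithLp.ofLp_sum, Finset.sum_apply, Finset.sum_congr rfl fun k _ => h2 k,
      Finset.sum_neg_distrib, Finset.sum_comm]
    simp only [← Finset.mul_sum, h1]
    simp
  have hcov : ∀ u, ∑ k ∈ Finset.Icc a b, inner ℝ (y k) (R u) • y k
      = ((b - a + 1 : ℤ) : ℝ) • (Q u + inner ℝ μ (R u) • μ) := by
    intro u
    ext j
    have hin : ∀ z : EuclideanSpace ℝ (Fin d), inner ℝ z (R u) = ∑ i, R u i * z i := fun z => by
      simp [PiLp.inner_apply]
    rw [WithLp.ofLp_sum, Finset.sum_apply]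
    simp only [PiLp.smul_apply, PiLp.add_apply, smul_eq_mul, hin, Finset.sum_mul]
    rw [Finset.sum_comm]
    simp only [mul_assoc, ← Finset.mul_sum, hcoord]
    simp only [mul_left_comm _ ((b - a + 1 : ℤ) : ℝ), ← Finset.mul_sum, mul_add,
      Finset.sum_add_distrib]
    congr 2
    simp only [mul_ite, mul_zero, Finset.sum_ite_eq', Finset.mem_univ, if_true, Q, R,
      coordScale_apply]
    split_ifs with h
    · have : lam j ≠ 0 := (lt_of_lt_of_le hc ((hJ j).1 h)).ne'
      field_simp
    · simp
  have hQfix : ∀ u : EuclideanSpace ℝ (Fin d), (∀ i, i ∉ J → u i = 0) → Q u = u := by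
    intro u hu
    ext i
    simp only [Q, coordScale_apply]
    split_ifs with h
    · simp
    · exact (hu i h).symm
  have hmain := norm_regression_sub_le y (a := a) (b := b) β Q R μ hc hM hab hnormal hcov
    (norm_coordScale_le J _ (inv_nonneg.2 hc.le) fun i hi => by
      have := (hJ i).1 hi
      rw [abs_inv, abs_of_pos (hc.trans_le this)]
      gcongr)
    (fun u => by simpa using norm_coordScale_le J (fun _ => 1) zero_le_one (by simp) u)
    (fun u => hQfix _ fun i hi => by simp [Q, coordScale_apply, hi])
    (hQfix _ fun i hi => hJ0 i hi b (by simp; omega)) (hQfix _ hm0)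
    ((mul_le_mul_of_nonneg_left (norm_toLp_score_le hv.orthonormal m)
      (by exact_mod_cast (by omega : 0 ≤ b - a + 1))).trans hmM)
    ((norm_toLp_score_le hv.orthonormal _).trans hxb)
    ((Finset.sum_le_sum fun k _ => norm_toLp_score_le hv.orthonormal (x k)).trans hx) hN
  refine le_trans (le_of_eq ?_) hmain
  rw [← norm_sum_smul_of_orthonormal hv.orthonormal]
  congr 1
  simp only [PiLp.sub_apply, sub_smul, Finset.sum_sub_distrib]
  congr 1
  -- Bosq's sum runs over all indices, but outside `J` the score of `x b` is zero, so the value of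
  -- `(lam i)⁻¹` there is immaterial.
  have hI : ∀ k, inner ℝ (y (k - 1)) (R (y b))
      = ∑ i, (lam i)⁻¹ * inner ℝ (x b) (v i) * inner ℝ (x (k - 1)) (v i) := by
    intro k
    rw [PiLp.inner_apply]
    refine Finset.sum_congr rfl fun i _ => ?_
    simp only [R, coordScale_apply, hyi, RCLike.inner_apply, conj_trivial]
    split_ifs with h
    · rfl
    · rw [hJ0 i h b (by simp; omega)]; simp
  have hB' : bosqPredictor lam v x a b = ((b - a : ℤ) : ℝ)⁻¹ • ∑ k ∈ Finset.Icc (a + 1) b,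
      ∑ j, (inner ℝ (y (k - 1)) (R (y b)) * y k j) • v j := by
    rw [bosqPredictor, bosqOperator]
    congr 1
    refine Finset.sum_congr rfl fun k _ => ?_
    rw [Finset.sum_comm]
    refine Finset.sum_congr rfl fun j _ => ?_
    rw [← Finset.sum_smul, hI, Finset.sum_mul]
    rfl
  rw [hB', Finset.sum_comm, Finset.smul_sum]
  refine Finset.sum_congr rfl fun j _ => ?_
  rw [← Finset.sum_smul, smul_smul]
  simp only [PiLp.smul_apply, WithLp.ofLp_sum, Finset.sum_apply, smul_eq_mul]

end Predictors

/-! ### Lower bounds for the empirical eigenvalues. -/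

section Eigenvalues

variable {E : Type*} [NormedAddCommGroup E] [InnerProductSpace ℝ E]

theorem inner_sampleCov_comm {m : E} {x : ℤ → E} {a b : ℤ} (e f : E) :
    inner ℝ (sampleCov m x a b e) f = inner ℝ e (sampleCov m x a b f) := by
  simp only [sampleCov, smul_apply, sum_apply, ContinuousLinearMap.smulRight_apply,
    innerSL_apply_apply, inner_smul_left, sum_inner, inner_smul_right, inner_sum]
  congr 1
  refine Finset.sum_congr rfl fun k _ => ?_
  rw [real_inner_comm e]
  simp only [conj_trivial]
  ring

/-- A min-max bound: if a quadratic form exceeds `c` on an `r`-dimensional space, with `r ≤ d`,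
then at least `r` of the `d` largest eigenvalues are at least `c`. -/
theorem IsLeadingEigensystem.le_card {T : E →L[ℝ] E} {d r : ℕ} {lam : Fin d → ℝ} {v : Fin d → E}
    (hv : IsLeadingEigensystem T lam v) (hT : ∀ e f, inner ℝ (T e) f = inner ℝ e (T f))
    (hr : r ≤ d) (e : Fin r → E) {c : ℝ}
    (hq : ∀ t : Fin r → ℝ, t ≠ 0 →
      c * ‖∑ i, t i • e i‖ ^ 2 < inner ℝ (T (∑ i, t i • e i)) (∑ i, t i • e i)) :
    r ≤ (Finset.univ.filter fun i => c ≤ lam i).card := by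
  set J := Finset.univ.filter fun i => c ≤ lam i with hJ
  by_contra hlt
  push Not at hlt
  let L : (Fin r → ℝ) →ₗ[ℝ] (J → ℝ) :=
    { toFun := fun t j => inner ℝ (v j) (∑ i, t i • e i)
      map_add' := fun s t => by
        ext j; simp [add_smul, Finset.sum_add_distrib, inner_add_right]
      map_smul' := fun s t => by
        ext j
        simp only [Pi.smul_apply, smul_eq_mul, mul_smul, ← Finset.smul_sum, inner_smul_right,
          RingHom.id_apply] }
  -- Fewer than `r` linear conditions on `r` coefficients leave a nonzero combination orthogonal to
  -- every eigenvector with eigenvalue at least `c`. On it the form is at most `c ‖x‖²`, a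
  -- contradiction.
  obtain ⟨t, ht0, htL⟩ : ∃ t : Fin r → ℝ, t ≠ 0 ∧ L t = 0 := by
    have h : LinearMap.ker L ≠ ⊥ := LinearMap.ker_ne_bot_of_finrank_lt (by simpa using hlt)
    obtain ⟨t, ht, ht0⟩ := Submodule.exists_mem_ne_zero_of_ne_bot h
    exact ⟨t, ht0, ht⟩
  have hx := hq t ht0
  set x := ∑ i, t i • e i with hxdef
  have hxJ : ∀ j, c ≤ lam j → inner ℝ (v j) x = 0 := fun j hj =>
    congrFun htL ⟨j, by simpa [hJ] using hj⟩
  -- An index with a small eigenvalue is needed so that `leading` bounds the form below `c` on the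
  -- part of `x` orthogonal to all the `v j`.
  obtain ⟨i₀, hi₀⟩ : ∃ i, lam i < c := by
    by_contra h
    push Not at h
    have : J = Finset.univ := by simp [hJ, h]
    rw [this, Finset.card_univ, Fintype.card_fin] at hlt
    omega
  set z := x - ∑ j, inner ℝ (v j) x • v j with hz
  have hz0 : ∀ j, inner ℝ (v j) z = 0 := by
    intro j
    rw [hz, inner_sub_right, hv.orthonormal.inner_right_fintype, sub_self]
  have hxz : x = z + ∑ j, inner ℝ (v j) x • v j := by rw [hz]; abel
  have hTz0 : ∀ j, inner ℝ (T z) (v j) = 0 := by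
    intro j
    rw [hT, hv.eigen, inner_smul_right, real_inner_comm, hz0, mul_zero]
  have hTx : inner ℝ (T x) x = inner ℝ (T z) z + ∑ j, lam j * inner ℝ (v j) x ^ 2 := by
    have h1 : inner ℝ (T x) x = inner ℝ (T x) z + ∑ j, inner ℝ (v j) x * inner ℝ (T x) (v j) := by
      nth_rewrite 2 [hxz]
      simp [inner_add_right, inner_sum, inner_smul_right]
    have h2 : inner ℝ (T x) z = inner ℝ (T z) z := by
      rw [hT, real_inner_comm]
      nth_rewrite 1 [hxz]
      simp [inner_add_right, inner_sum, inner_smul_right, hTz0]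
    rw [h1, h2]
    congr 1
    refine Finset.sum_congr rfl fun j _ => ?_
    rw [hT, hv.eigen, inner_smul_right, real_inner_comm]
    ring
  have hnorm : ‖x‖ ^ 2 = ‖z‖ ^ 2 + ∑ j, inner ℝ (v j) x ^ 2 := by
    have h1 : inner ℝ x x = inner ℝ x z + ∑ j, inner ℝ (v j) x * inner ℝ x (v j) := by
      nth_rewrite 2 [hxz]
      simp [inner_add_right, inner_sum, inner_smul_right]
    have h2 : inner ℝ x z = inner ℝ z z := by
      nth_rewrite 1 [hxz]
      simp [inner_add_left, sum_inner, inner_smul_left, hz0]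
    rw [← real_inner_self_eq_norm_sq, h1, h2, real_inner_self_eq_norm_sq]
    congr 1
    refine Finset.sum_congr rfl fun j _ => ?_
    rw [real_inner_comm, sq]
  have hlead := hv.leading i₀ z hz0
  have hsum : ∑ j, lam j * inner ℝ (v j) x ^ 2 ≤ ∑ j, c * inner ℝ (v j) x ^ 2 := by
    refine Finset.sum_le_sum fun j _ => ?_
    rcases le_or_gt c (lam j) with h | h
    · simp [hxJ j h]
    · gcongr
  rw [← Finset.mul_sum] at hsum
  have hzc : lam i₀ * ‖z‖ ^ 2 ≤ c * ‖z‖ ^ 2 := by gcongr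
  rw [hTx, hnorm, mul_add] at hx
  linarith

/-- A small perturbation of the identity matrix is positive definite. -/
theorem half_sum_sq_le {r : ℕ} (G : Fin r → Fin r → ℝ)
    (hG : ∀ i j, |G i j - if i = j then 1 else 0| ≤ 1 / (2 * (r + 1))) (t : Fin r → ℝ) :
    1 / 2 * ∑ i, t i ^ 2 ≤ ∑ i, ∑ j, t i * t j * G i j := by
  have h1 : ∑ i, t i ^ 2 - ∑ i, ∑ j, |t i| * |t j| * (1 / (2 * (r + 1)))
      ≤ ∑ i, ∑ j, t i * t j * G i j := by
    rw [← Finset.sum_sub_distrib]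
    refine Finset.sum_le_sum fun i _ => ?_
    have h2 : t i ^ 2 = ∑ j, t i * t j * (if i = j then 1 else 0) := by simp [sq]
    rw [h2, ← Finset.sum_sub_distrib]
    refine Finset.sum_le_sum fun j _ => ?_
    have h3 : |t i * t j * (G i j - if i = j then 1 else 0)|
        ≤ |t i| * |t j| * (1 / (2 * (r + 1))) := by
      rw [abs_mul, abs_mul]
      gcongr
      exact hG i j
    have h4 := neg_le_of_abs_le h3
    linarith
  have h2 : ∑ i, ∑ j, |t i| * |t j| * (1 / (2 * (r + 1)))
      = (∑ i, |t i|) ^ 2 * (1 / (2 * (r + 1))) := by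
    rw [sq, Finset.sum_mul_sum, Finset.sum_mul]
    simp only [Finset.sum_mul]
  have h3 : (∑ i, |t i|) ^ 2 ≤ r * ∑ i, t i ^ 2 := by
    have := sq_sum_le_card_mul_sum_sq (s := Finset.univ) (f := fun i => |t i|)
    simpa using this
  have h4 : (0 : ℝ) ≤ ∑ i, t i ^ 2 := Finset.sum_nonneg fun _ _ => sq_nonneg _
  have h5 : (∑ i, |t i|) ^ 2 * (1 / (2 * (r + 1))) ≤ 1 / 2 * ∑ i, t i ^ 2 := by
    rw [mul_one_div, div_le_iff₀ (by positivity)]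
    nlinarith
  linarith

/-- If the sample covariance operator is nearly orthonormal along `e_1, …, e_r`, with `r ≤ d`, and
either `r = d` or the observations lie in an `r`-dimensional space, then each of the `d` leading
eigenvalues is bounded below, or belongs to a direction in which all the observations vanish. -/
theorem IsLeadingEigensystem.le_or_inner_eq_zero {x : ℤ → E} {a b : ℤ} {m : E} {d r : ℕ}
    {lam : Fin d → ℝ} {v : Fin d → E} (hm : m = 0 ∨ m = sampleMean x a b)
    (hv : IsLeadingEigensystem (sampleCov m x a b) lam v) (hr : r ≤ d) (e : Fin r → E)
    (hG : ∀ i j, |inner ℝ (sampleCov m x a b (e i)) (e j) - if i = j then 1 else 0|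
      ≤ 1 / (2 * (r + 1)))
    (hV : r = d ∨ ∃ f : Fin r → E, ∀ k ∈ Finset.Icc a b, x k ∈ Submodule.span ℝ (Set.range f))
    (i : Fin d) :
    1 / (2 * (∑ i, ‖e i‖ ^ 2 + 1)) ≤ lam i ∨ ∀ k ∈ Finset.Icc a b, inner ℝ (x k) (v i) = 0 := by
  -- The form is at least half of `∑ t i ^ 2`, while Cauchy-Schwarz bounds the squared norm by `(∑ t
  -- i ^ 2) * ∑ ‖e i‖ ^ 2`. The added one makes the comparison strict.
  set c := 1 / (2 * (∑ i, ‖e i‖ ^ 2 + 1)) with hc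
  have hK : 0 ≤ ∑ i, ‖e i‖ ^ 2 := Finset.sum_nonneg fun _ _ => sq_nonneg _
  have hc0 : 0 < c := by positivity
  have hcard := hv.le_card inner_sampleCov_comm hr e (c := c) (by
    intro t ht
    have h1 := half_sum_sq_le _ hG t
    have h2 : inner ℝ (sampleCov m x a b (∑ i, t i • e i)) (∑ i, t i • e i)
        = ∑ i, ∑ j, t i * t j * inner ℝ (sampleCov m x a b (e i)) (e j) := by
      simp only [map_sum, map_smul, sum_inner, inner_sum, inner_smul_left, inner_smul_right,
        conj_trivial]
      rw [Finset.sum_comm]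
      refine Finset.sum_congr rfl fun i _ => ?_
      rw [Finset.mul_sum]
      refine Finset.sum_congr rfl fun j _ => ?_
      ring
    rw [h2]
    have h3 : ‖∑ i, t i • e i‖ ^ 2 ≤ (∑ i, t i ^ 2) * ∑ i, ‖e i‖ ^ 2 := by
      have h4 : ‖∑ i, t i • e i‖ ≤ ∑ i, |t i| * ‖e i‖ :=
        (norm_sum_le _ _).trans (le_of_eq (by simp [norm_smul]))
      calc _ ≤ (∑ i, |t i| * ‖e i‖) ^ 2 := by gcongr
        _ ≤ (∑ i, |t i| ^ 2) * ∑ i, ‖e i‖ ^ 2 := Finset.sum_mul_sq_le_sq_mul_sq _ _ _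
        _ = _ := by simp
    have h5 : 0 < ∑ i, t i ^ 2 := by
      obtain ⟨i, hi⟩ := Function.ne_iff.1 ht
      exact Finset.sum_pos' (fun _ _ => sq_nonneg _) ⟨i, Finset.mem_univ _, by
        have : t i ≠ 0 := hi
        positivity⟩
    refine lt_of_lt_of_le ?_ h1
    refine (mul_le_mul_of_nonneg_left h3 hc0.le).trans_lt ?_
    rw [hc, one_div_mul_eq_div, div_lt_iff₀ (by positivity)]
    nlinarith)
  set J := Finset.univ.filter fun i => c ≤ lam i with hJ
  rcases hV with rfl | ⟨f, hf⟩
  · left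
    have : J = Finset.univ := by
      rw [← Finset.card_eq_iff_eq_univ, Fintype.card_fin]
      exact le_antisymm ((Finset.card_le_univ _).trans (by simp)) hcard
    have hi := this ▸ Finset.mem_univ i
    simpa [hJ] using hi
  · by_cases hi : c ≤ lam i
    · exact Or.inl hi
    right
    set V := Submodule.span ℝ (Set.range f) with hVdef
    have : FiniteDimensional ℝ V := FiniteDimensional.span_of_finite ℝ (Set.finite_range f)
    have hmV : m ∈ V := by
      rcases hm with hm | hm
      · rw [hm]; exact V.zero_mem
      · rw [hm]; exact V.smul_mem _ (V.sum_mem hf)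
    have hTV : ∀ z, sampleCov m x a b z ∈ V := by
      intro z
      simp only [sampleCov, smul_apply, sum_apply, ContinuousLinearMap.smulRight_apply]
      exact V.smul_mem _ (V.sum_mem fun k hk => V.smul_mem _ (V.sub_mem (hf k hk) hmV))
    have hvV : ∀ j ∈ J, v j ∈ V := by
      intro j hj
      have hj' : c ≤ lam j := by simpa [hJ] using hj
      have h1 : v j = (lam j)⁻¹ • sampleCov m x a b (v j) := by
        rw [hv.eigen, smul_smul, inv_mul_cancel₀ (hc0.trans_le hj').ne', one_smul]
      rw [h1]
      exact V.smul_mem _ (hTV _)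
    -- At least `r` orthonormal vectors lie in a space of dimension at most `r`, so they span it.
    -- The remaining eigenvectors are then orthogonal to `V` and to the data.
    have hspan : Submodule.span ℝ (Set.range fun j : J => v j) = V := by
      refine Submodule.eq_of_le_of_finrank_le ?_ ?_
      · rw [Submodule.span_le]
        rintro _ ⟨j, rfl⟩
        exact hvV j j.2
      · have hli : LinearIndependent ℝ fun j : J => v j :=
          hv.orthonormal.linearIndependent.comp _ Subtype.val_injective
        rw [finrank_span_eq_card hli]
        refine (finrank_range_le_card f).trans ?_
        simpa using hcard
    intro k hk
    have hxk := hf k hk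
    rw [← hspan] at hxk
    have hle : Submodule.span ℝ (Set.range fun j : J => v j) ≤ (Submodule.span ℝ {v i})ᗮ := by
      rw [Submodule.span_le]
      rintro _ ⟨j, rfl⟩
      rw [SetLike.mem_coe, Submodule.mem_orthogonal_singleton_iff_inner_left]
      refine hv.orthonormal.2 fun hji => hi ?_
      have := j.2
      rw [hji] at this
      simpa [hJ] using this
    exact Submodule.mem_orthogonal_singleton_iff_inner_left.1 (hle hxk)

end Eigenvalues

/-! ### Laws of large numbers in `L¹` for real sequences. -/

section LawOfLargeNumbers

variable {Ω : Type*} [MeasurableSpace Ω] {P : Measure Ω}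

/-- The law of large numbers in `L¹` follows from the laws along all residue classes modulo `m`. -/
theorem tendsto_integral_abs_average_of_residues (V : ℕ → Ω → ℝ) {m : ℕ} (hm : 0 < m)
    (hint : ∀ k, Integrable (V k) P) {K : ℝ} (hK : ∀ k, ∫ ω, |V k ω| ∂P ≤ K)
    (hres : ∀ r < m, Tendsto (fun J : ℕ => (J : ℝ)⁻¹ *
      ∫ ω, |∑ j ∈ Finset.range J, V (m * j + r) ω| ∂P) atTop (nhds 0)) :
    Tendsto (fun N : ℕ => (N : ℝ)⁻¹ * ∫ ω, |∑ k ∈ Finset.range N, V k ω| ∂P) atTop (nhds 0) := by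
  have hK0 : 0 ≤ K := (integral_nonneg fun _ => abs_nonneg _).trans (hK 0)
  have hsplit : ∀ J t : ℕ, ∀ ω, ∑ k ∈ Finset.range (m * J + t), V k ω
      = ∑ r ∈ Finset.range m, ∑ j ∈ Finset.range J, V (m * j + r) ω
        + ∑ r ∈ Finset.range t, V (m * J + r) ω := by
    intro J t ω
    rw [Finset.sum_range_add]
    congr 1
    induction J with
    | zero => simp
    | succ J ih =>
      rw [mul_add, mul_one, Finset.sum_range_add, ih, ← Finset.sum_add_distrib]
      simp only [Finset.sum_range_succ]
  have hsumint : ∀ r J, Integrable (fun ω => |∑ j ∈ Finset.range J, V (m * j + r) ω|) P :=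
    fun r J => (integrable_finsetSum _ fun j _ => hint _).abs
  -- Each residue class contributes `N / m` complete terms; fewer than `m` terms remain, at a cost
  -- of at most `m * K`.
  have hbound : ∀ N : ℕ, (N : ℝ)⁻¹ * ∫ ω, |∑ k ∈ Finset.range N, V k ω| ∂P
      ≤ ∑ r ∈ Finset.range m, (((N / m : ℕ) : ℝ)⁻¹ *
        ∫ ω, |∑ j ∈ Finset.range (N / m), V (m * j + r) ω| ∂P) + (N : ℝ)⁻¹ * (m * K) := by
    intro N
    have h1 : ∫ ω, |∑ k ∈ Finset.range N, V k ω| ∂P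
        ≤ ∑ r ∈ Finset.range m, ∫ ω, |∑ j ∈ Finset.range (N / m), V (m * j + r) ω| ∂P
          + m * K := by
      have h2 : ∀ ω, |∑ k ∈ Finset.range N, V k ω|
          ≤ ∑ r ∈ Finset.range m, |∑ j ∈ Finset.range (N / m), V (m * j + r) ω|
            + ∑ r ∈ Finset.range (N % m), |V (m * (N / m) + r) ω| := by
        intro ω
        have h3 := hsplit (N / m) (N % m) ω
        rw [Nat.div_add_mod] at h3
        rw [h3]
        exact (abs_add_le _ _).trans
          (add_le_add (Finset.abs_sum_le_sum_abs _ _) (Finset.abs_sum_le_sum_abs _ _))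
      have hi1 : Integrable (fun ω => ∑ r ∈ Finset.range m,
          |∑ j ∈ Finset.range (N / m), V (m * j + r) ω|) P :=
        integrable_finsetSum _ fun r _ => hsumint r _
      have hi2 : Integrable (fun ω => ∑ r ∈ Finset.range (N % m), |V (m * (N / m) + r) ω|) P :=
        integrable_finsetSum _ fun r _ => (hint _).abs
      refine (integral_mono (integrable_finsetSum _ fun j _ => hint _).abs (hi1.add hi2) h2).trans ?_
      simp only [Pi.add_apply]
      rw [integral_add hi1 hi2, integral_finsetSum _ fun r _ => hsumint r _,
        integral_finsetSum _ fun r _ => (hint _).abs]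
      gcongr
      calc _ ≤ ∑ r ∈ Finset.range (N % m), K := Finset.sum_le_sum fun r _ => hK _
        _ = (N % m : ℕ) * K := by simp
        _ ≤ m * K := by
          gcongr
          exact (Nat.mod_lt _ hm).le
    calc _ ≤ (N : ℝ)⁻¹ * (∑ r ∈ Finset.range m,
            ∫ ω, |∑ j ∈ Finset.range (N / m), V (m * j + r) ω| ∂P + m * K) := by gcongr
      _ ≤ _ := by
          rw [mul_add, Finset.mul_sum]
          refine add_le_add (Finset.sum_le_sum fun r _ => ?_) le_rfl
          rcases Nat.eq_zero_or_pos (N / m) with h0 | h0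
          · simp [h0]
          · gcongr
            exact Nat.div_le_self N m
  refine squeeze_zero (fun N => by positivity) hbound ?_
  have h1 : Tendsto (fun N : ℕ => ∑ r ∈ Finset.range m, (((N / m : ℕ) : ℝ)⁻¹ *
        ∫ ω, |∑ j ∈ Finset.range (N / m), V (m * j + r) ω| ∂P)) atTop (nhds 0) := by
    rw [← Finset.sum_const_zero (s := Finset.range m)]
    refine tendsto_finsetSum _ fun r hr => ?_
    exact (hres r (Finset.mem_range.1 hr)).comp (Nat.tendsto_div_const_atTop hm.ne')
  have h2 : Tendsto (fun N : ℕ => (N : ℝ)⁻¹ * (m * K)) atTop (nhds 0) := by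
    simpa using tendsto_inv_atTop_nhds_zero_nat.mul_const (m * K : ℝ)
  simpa using h1.add h2

theorem tendsto_integral_abs_average_of_indep [IsProbabilityMeasure P] (U : ℕ → Ω → ℝ)
    (hint : Integrable (U 0) P)
    (hindep : Pairwise (Function.onFun (fun f g => IndepFun f g P) U))
    (hident : ∀ k, IdentDistrib (U k) (U 0) P P) :
    Tendsto (fun N : ℕ => (N : ℝ)⁻¹ *
      ∫ ω, |∑ k ∈ Finset.range N, (U k ω - ∫ ω, U 0 ω ∂P)| ∂P) atTop (nhds 0) := by
  have h := strong_law_Lp le_rfl ENNReal.one_ne_top U (memLp_one_iff_integrable.2 hint)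
    hindep hident
  have h2 := (ENNReal.tendsto_toReal ENNReal.zero_ne_top).comp h
  refine (h2.congr' ?_)
  filter_upwards [eventually_gt_atTop 0] with N hN
  have hi : ∀ k, Integrable (U k) P := fun k => (hident k).integrable_iff.2 hint
  have hN' : (N : ℝ) ≠ 0 := by positivity
  have hi2 : Integrable (fun ω => (N : ℝ)⁻¹ • ∑ i ∈ Finset.range N, U i ω - ∫ x, U 0 x ∂P) P :=
    Integrable.sub (f := fun ω => (N : ℝ)⁻¹ • ∑ i ∈ Finset.range N, U i ω)
      ((integrable_finsetSum _ fun j _ => hi j).const_mul _) (integrable_const _)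
  simp only [Function.comp_apply]
  rw [eLpNorm_one_eq_lintegral_enorm, ← integral_norm_eq_lintegral_enorm hi2.aestronglyMeasurable,
    ← integral_const_mul]
  refine integral_congr_ae (Eventually.of_forall fun ω => ?_)
  simp only
  rw [Finset.sum_sub_distrib, Finset.sum_const, Finset.card_range, Real.norm_eq_abs,
    ← abs_of_nonneg (by positivity : (0 : ℝ) ≤ (N : ℝ)⁻¹), ← abs_mul,
    abs_of_nonneg (by positivity : (0 : ℝ) ≤ (N : ℝ)⁻¹), nsmul_eq_mul, smul_eq_mul]
  congr 1
  field_simp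

end LawOfLargeNumbers

/-! ### First order autoregressions and their moving average truncations. -/

section HilbertianAR

variable {Ω : Type*} [MeasurableSpace Ω] {E : Type*} [NormedAddCommGroup E]
  [InnerProductSpace ℝ E] [MeasurableSpace E]

/-- A stationary first order autoregressive process `X_k = T X_{k-1} + ε_k` in a Hilbert space,
with i.i.d. centred square integrable innovations. -/
structure IsStationaryAR (P : Measure Ω) (T : E →L[ℝ] E) (ε X : ℤ → Ω → E) : Prop where
  measurable_innov : ∀ k, Measurable (ε k)
  indep : iIndepFun ε P
  identDistrib_innov : ∀ k, IdentDistrib (ε k) (ε 0) P P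
  memLp_innov : ∀ k, MemLp (ε k) 2 P
  centred : ∀ k, ∫ ω, ε k ω ∂P = 0
  measurable : ∀ k, Measurable (X k)
  memLp : ∀ k, MemLp (X k) 2 P
  recursion : ∀ k, ∀ᵐ ω ∂P, X k ω = T (X (k - 1) ω) + ε k ω
  identDistrib_pair : ∀ k l, IdentDistrib (fun ω => (X k ω, X (k - l) ω))
    (fun ω => (X 0 ω, X (0 - l) ω)) P P
  exists_pow_lt : ∃ k₀ : ℕ, 1 ≤ k₀ ∧ ‖T ^ k₀‖ < 1

/-- The moving average part of order `m` of an autoregressive process. -/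
def movingAverage (T : E →L[ℝ] E) (ε : ℤ → Ω → E) (m : ℕ) (k : ℤ) (ω : Ω) : E :=
  ∑ i ∈ Finset.range m, (T ^ i) (ε (k - i) ω)

namespace IsStationaryAR

variable {P : Measure Ω} {T : E →L[ℝ] E} {ε X : ℤ → Ω → E}

theorem identDistrib (h : IsStationaryAR P T ε X) (k : ℤ) : IdentDistrib (X k) (X 0) P P :=
  (h.identDistrib_pair k 0).comp measurable_fst

theorem eq_movingAverage_add (h : IsStationaryAR P T ε X) :
    ∀ᵐ ω ∂P, ∀ (m : ℕ) (k : ℤ), X k ω = movingAverage T ε m k ω + (T ^ m) (X (k - m) ω) := by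
  have h1 : ∀ᵐ ω ∂P, ∀ k, X k ω = T (X (k - 1) ω) + ε k ω := ae_all_iff.2 h.recursion
  filter_upwards [h1] with ω hω m
  induction m with
  | zero => simp [movingAverage]
  | succ m ih =>
    intro k
    have h2 : (T ^ m) (X (k - m) ω) = (T ^ (m + 1)) (X (k - (m + 1 : ℕ)) ω)
        + (T ^ m) (ε (k - m) ω) := by
      rw [hω (k - m), map_add, pow_succ, mul_apply_eq_comp,
        show k - ((m + 1 : ℕ) : ℤ) = k - m - 1 by push_cast; ring]
    rw [ih k, h2, movingAverage, movingAverage, Finset.sum_range_succ]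
    abel

theorem memLp_movingAverage (h : IsStationaryAR P T ε X) (m : ℕ) (k : ℤ) :
    MemLp (movingAverage T ε m k) 2 P := by
  unfold movingAverage
  exact memLp_finsetSum _ fun i _ => (T ^ i).comp_memLp' (h.memLp_innov _)

variable [BorelSpace E] [SecondCountableTopology E]

/-- The window at time `k` uses the innovations at times `k - m + 1, …, k`; windows at least `m`
apart share none. -/
theorem indepFun_movingAverage (h : IsStationaryAR P T ε X) {m : ℕ} {k l : ℤ} (hkl : l + m ≤ k) :
    IndepFun (movingAverage T ε m k) (movingAverage T ε m l) P := by
  classical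
  let S : ℤ → Finset ℤ := fun k => (Finset.range m).image fun i : ℕ => k - (i : ℤ)
  have hmem : ∀ (k : ℤ) (i : Finset.range m), k - ((i : ℕ) : ℤ) ∈ S k := fun k i =>
    Finset.mem_image_of_mem _ i.2
  have hdisj : Disjoint (S k) (S l) := by
    rw [Finset.disjoint_left]
    intro a ha hb
    simp only [S, Finset.mem_image, Finset.mem_range] at ha hb
    obtain ⟨i, hi, rfl⟩ := ha
    obtain ⟨j, hj, hij⟩ := hb
    omega
  have hind := h.indep.indepFun_finset (S k) (S l) hdisj h.measurable_innov
  let φ : ∀ k : ℤ, (S k → E) → E := fun k g =>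
    ∑ i : Finset.range m, (T ^ (i : ℕ)) (g ⟨k - ((i : ℕ) : ℤ), hmem k i⟩)
  have hφ : ∀ k, Measurable (φ k) := by
    intro k
    simp only [φ]
    fun_prop
  have hcomp := hind.comp (hφ k) (hφ l)
  have heq : ∀ k, (φ k ∘ fun ω (i : S k) => ε i ω) = movingAverage T ε m k := by
    intro k
    ext ω
    simp only [φ, Function.comp_apply, movingAverage]
    exact Finset.sum_coe_sort (Finset.range m) (fun i => (T ^ i) (ε (k - (i : ℤ)) ω))
  rwa [heq, heq] at hcomp

/-- The truncation equals `X_k - T^m X_{k-m}` almost surely, so stationarity of pairs is enough. -/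
theorem identDistrib_movingAverage (h : IsStationaryAR P T ε X) (m : ℕ) (k : ℤ) :
    IdentDistrib (movingAverage T ε m k) (movingAverage T ε m 0) P P := by
  have h1 : ∀ k, (fun ω => X k ω - (T ^ m) (X (k - m) ω)) =ᵐ[P] movingAverage T ε m k := by
    intro k
    filter_upwards [h.eq_movingAverage_add] with ω hω
    rw [hω m k]; abel
  have hmeas : Measurable fun z : E × E => z.1 - (T ^ m) z.2 := by fun_prop
  have h2 := (h.identDistrib_pair k m).comp hmeas
  have h3 : ∀ k, AEMeasurable (fun ω => X k ω - (T ^ m) (X (k - m) ω)) P := fun k =>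
    ((h.measurable k).sub ((T ^ m).measurable.comp (h.measurable _))).aemeasurable
  exact ((IdentDistrib.of_ae_eq (h3 k) (h1 k)).symm.trans h2).trans
    (IdentDistrib.of_ae_eq (h3 0) (h1 0))

end IsStationaryAR

end HilbertianAR

/-! ### Moments of partial sums and convergence of cross moments. -/

section Moments

variable {Ω : Type*} [MeasurableSpace Ω] {E : Type*} [NormedAddCommGroup E]
  [InnerProductSpace ℝ E] {P : Measure Ω}

theorem integrable_inner_mul_inner {Z : Ω → E} (hZ : MemLp Z 2 P) (e f : E) :
    Integrable (fun ω => inner ℝ (Z ω) e * inner ℝ (Z ω) f) P :=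
  (hZ.inner_const e).integrable_mul (hZ.inner_const f)

variable [MeasurableSpace E]

namespace IsStationaryAR

variable {T : E →L[ℝ] E} {ε X : ℤ → Ω → E}

theorem integrable_norm_sq (h : IsStationaryAR P T ε X) (k : ℤ) :
    Integrable (fun ω => ‖X k ω‖ ^ 2) P :=
  (h.memLp k).integrable_norm_pow two_ne_zero

/-- A left inverse of `1 - T` is `(1 - T^k₀)⁻¹ ∑ T^i` over `i < k₀`, with the first factor given by
a Neumann series. It recovers a partial sum of `X` from its image under `1 - T`, which telescopes.
-/
theorem exists_norm_le_norm_sub [CompleteSpace E] (h : IsStationaryAR P T ε X) :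
    ∃ κ : ℝ, 0 ≤ κ ∧ ∀ z, ‖z‖ ≤ κ * ‖z - T z‖ := by
  obtain ⟨k₀, -, hlt⟩ := h.exists_pow_lt
  let u := Units.oneSub (T ^ k₀) hlt
  let A : E →L[ℝ] E := (↑u⁻¹ : E →L[ℝ] E) * ∑ i ∈ Finset.range k₀, T ^ i
  have hA : A * (1 - T) = 1 := by
    have h1 : (∑ i ∈ Finset.range k₀, T ^ i) * (1 - T) = u := geom_sum_mul_neg T k₀
    rw [mul_assoc, h1, Units.inv_mul]
  refine ⟨‖A‖, norm_nonneg _, fun z => ?_⟩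
  have h2 : z = A (z - T z) := by
    have := DFunLike.congr_fun hA z
    exact this.symm
  nth_rewrite 1 [h2]
  exact A.le_opNorm _

variable [BorelSpace E]

theorem integral_norm_sq (h : IsStationaryAR P T ε X) (k : ℤ) :
    ∫ ω, ‖X k ω‖ ^ 2 ∂P = ∫ ω, ‖X 0 ω‖ ^ 2 ∂P :=
  ((h.identDistrib k).comp (u := fun z => ‖z‖ ^ 2) (by fun_prop)).integral_eq

/-- The cross moments of the process are approximated by those of its moving average parts. -/
theorem integral_abs_crossMoment_sub_le (h : IsStationaryAR P T ε X) (m : ℕ) (k : ℤ) (e f : E) :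
    ∫ ω, |inner ℝ (X k ω) e * inner ℝ (X k ω) f
        - inner ℝ (movingAverage T ε m k ω) e * inner ℝ (movingAverage T ε m k ω) f| ∂P
      ≤ ‖e‖ * ‖f‖ * (2 * ‖T ^ m‖ + ‖T ^ m‖ ^ 2) * ∫ ω, ‖X 0 ω‖ ^ 2 ∂P := by
  set ρ := ‖T ^ m‖ with hρ
  have hi : Integrable (fun ω => ‖e‖ * ‖f‖ * (ρ * ‖X k ω‖ ^ 2 + (ρ + ρ ^ 2) * ‖X (k - m) ω‖ ^ 2)) P :=
    (((h.integrable_norm_sq k).const_mul _).add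
      ((h.integrable_norm_sq (k - m)).const_mul _)).const_mul _
  have hle : ∀ᵐ ω ∂P, |inner ℝ (X k ω) e * inner ℝ (X k ω) f
        - inner ℝ (movingAverage T ε m k ω) e * inner ℝ (movingAverage T ε m k ω) f|
      ≤ ‖e‖ * ‖f‖ * (ρ * ‖X k ω‖ ^ 2 + (ρ + ρ ^ 2) * ‖X (k - m) ω‖ ^ 2) := by
    filter_upwards [h.eq_movingAverage_add] with ω hω
    set x := X k ω
    set x' := X (k - m) ω
    set z := movingAverage T ε m k ω
    set R := (T ^ m) x' with hR
    have hxz : x = z + R := hω m k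
    have hzx : z = x - R := by rw [hxz]; abel
    have hRn : ‖R‖ ≤ ρ * ‖x'‖ := (T ^ m).le_opNorm x'
    have hzn : ‖z‖ ≤ ‖x‖ + ‖R‖ := by rw [hzx]; exact norm_sub_le _ _
    -- Every term contains the remainder `R`, which is of size `‖T ^ m‖`.
    have h1 : inner ℝ x e * inner ℝ x f - inner ℝ z e * inner ℝ z f
        = inner ℝ R e * inner ℝ x f + inner ℝ z e * inner ℝ R f := by
      have h2 : ∀ g, inner ℝ R g = inner ℝ x g - inner ℝ z g := fun g => by
        rw [hxz, inner_add_left]; ring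
      rw [h2, h2]; ring
    rw [h1]
    have h3 : |inner ℝ R e * inner ℝ x f| ≤ ‖R‖ * ‖e‖ * (‖x‖ * ‖f‖) := by
      rw [abs_mul]
      exact mul_le_mul (abs_real_inner_le_norm _ _) (abs_real_inner_le_norm _ _) (abs_nonneg _)
        (by positivity)
    have h4 : |inner ℝ z e * inner ℝ R f| ≤ (‖x‖ + ‖R‖) * ‖e‖ * (‖R‖ * ‖f‖) := by
      rw [abs_mul]
      exact mul_le_mul ((abs_real_inner_le_norm _ _).trans (by gcongr))
        (abs_real_inner_le_norm _ _) (abs_nonneg _) (by positivity)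
    have h5 : 2 * (‖R‖ * ‖x‖) + ‖R‖ * ‖R‖ ≤ ρ * ‖x‖ ^ 2 + (ρ + ρ ^ 2) * ‖x'‖ ^ 2 := by
      have h6 : ‖R‖ * ‖x‖ ≤ ρ * ‖x'‖ * ‖x‖ := by gcongr
      have h7 : ‖R‖ * ‖R‖ ≤ (ρ * ‖x'‖) * (ρ * ‖x'‖) := by gcongr
      have h8 : 0 ≤ ρ * (‖x‖ - ‖x'‖) ^ 2 := by positivity
      nlinarith
    calc _ ≤ _ := abs_add_le _ _
      _ ≤ ‖R‖ * ‖e‖ * (‖x‖ * ‖f‖) + (‖x‖ + ‖R‖) * ‖e‖ * (‖R‖ * ‖f‖) := add_le_add h3 h4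
      _ = ‖e‖ * ‖f‖ * (2 * (‖R‖ * ‖x‖) + ‖R‖ * ‖R‖) := by ring
      _ ≤ _ := by gcongr
  refine (integral_mono_ae ((integrable_inner_mul_inner (h.memLp k) e f).sub
    (integrable_inner_mul_inner (h.memLp_movingAverage m k) e f)).abs hi hle).trans (le_of_eq ?_)
  rw [integral_const_mul, integral_add ((h.integrable_norm_sq k).const_mul _)
    ((h.integrable_norm_sq (k - m)).const_mul _), integral_const_mul, integral_const_mul,
    h.integral_norm_sq k, h.integral_norm_sq (k - m)]
  ring

/-- The innovations are orthogonal, so that the second moment of their partial sums is additive. -/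
theorem integral_norm_sum_innov_sq [CompleteSpace E] [IsProbabilityMeasure P]
    (h : IsStationaryAR P T ε X) (s : ℤ) (N : ℕ) :
    ∫ ω, ‖∑ k ∈ Finset.range N, ε (s + (k : ℕ)) ω‖ ^ 2 ∂P = N * ∫ ω, ‖ε 0 ω‖ ^ 2 ∂P := by
  have hin : ∀ k l, Integrable (fun ω => inner ℝ (ε k ω) (ε l ω)) P := fun k l =>
    ((h.memLp_innov k).norm.integrable_mul (h.memLp_innov l).norm).mono'
      ((h.memLp_innov k).aestronglyMeasurable.inner (h.memLp_innov l).aestronglyMeasurable)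
      (Eventually.of_forall fun ω => norm_inner_le_norm _ _)
  have h1 : ∀ ω, ‖∑ k ∈ Finset.range N, ε (s + (k : ℕ)) ω‖ ^ 2
      = ∑ k ∈ Finset.range N, ∑ l ∈ Finset.range N,
        inner ℝ (ε (s + (k : ℕ)) ω) (ε (s + (l : ℕ)) ω) := by
    intro ω
    rw [← real_inner_self_eq_norm_sq, sum_inner]
    simp only [inner_sum]
  have h2 : ∀ k l : ℤ, ∫ ω, inner ℝ (ε k ω) (ε l ω) ∂P
      = if k = l then ∫ ω, ‖ε 0 ω‖ ^ 2 ∂P else 0 := by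
    intro k l
    split_ifs with hkl
    · subst hkl
      simp only [real_inner_self_eq_norm_sq]
      exact ((h.identDistrib_innov k).comp (u := fun z => ‖z‖ ^ 2) (by fun_prop)).integral_eq
    · have := (h.indep.indepFun hkl).integral_bilin
        ((h.memLp_innov k).integrable one_le_two) ((h.memLp_innov l).integrable one_le_two)
        (innerSL ℝ)
      rw [h.centred, map_zero] at this
      exact this
  simp only [h1]
  rw [integral_finsetSum _ fun k _ => integrable_finsetSum _ fun l _ => hin _ _]
  have h3 : ∀ k ∈ Finset.range N, ∫ ω, ∑ l ∈ Finset.range N,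
      inner ℝ (ε (s + (k : ℕ)) ω) (ε (s + (l : ℕ)) ω) ∂P = ∫ ω, ‖ε 0 ω‖ ^ 2 ∂P := by
    intro k hk
    rw [integral_finsetSum _ fun l _ => hin _ _]
    simp [h2, Finset.mem_range.1 hk]
  rw [Finset.sum_congr rfl h3]
  simp

/-- The partial sums of the process have second moments of at most linear growth. -/
theorem exists_integral_norm_sum_sq_le [CompleteSpace E] [IsProbabilityMeasure P]
    (h : IsStationaryAR P T ε X) : ∃ K : ℝ, 0 ≤ K ∧ ∀ (s : ℤ) (N : ℕ),
      ∫ ω, ‖∑ k ∈ Finset.range N, X (s + (k : ℕ)) ω‖ ^ 2 ∂P ≤ K * (N + 1) := by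
  obtain ⟨κ, hκ0, hκ⟩ := h.exists_norm_le_norm_sub
  set σ := ∫ ω, ‖X 0 ω‖ ^ 2 ∂P with hσ
  set τ := ∫ ω, ‖ε 0 ω‖ ^ 2 ∂P with hτ
  have hσ0 : 0 ≤ σ := integral_nonneg fun _ => by positivity
  have hτ0 : 0 ≤ τ := integral_nonneg fun _ => by positivity
  refine ⟨κ ^ 2 * (3 * (2 * σ + τ)), by positivity, fun s N => ?_⟩
  have hS : Integrable (fun ω => ‖∑ k ∈ Finset.range N, ε (s + 1 + (k : ℕ)) ω‖ ^ 2) P :=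
    (memLp_finsetSum _ fun k _ => h.memLp_innov _).integrable_norm_pow two_ne_zero
  have hle : ∀ᵐ ω ∂P, ‖∑ k ∈ Finset.range N, X (s + (k : ℕ)) ω‖ ^ 2
      ≤ κ ^ 2 * (3 * (‖X s ω‖ ^ 2 + ‖X (s + N) ω‖ ^ 2
        + ‖∑ k ∈ Finset.range N, ε (s + 1 + (k : ℕ)) ω‖ ^ 2)) := by
    filter_upwards [ae_all_iff.2 h.recursion] with ω hω
    set S := ∑ k ∈ Finset.range N, ε (s + 1 + (k : ℕ)) ω with hSdef
    set x := ∑ k ∈ Finset.range N, X (s + (k : ℕ)) ω with hx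
    -- The recursion turns `x - T x` into two boundary terms plus a sum of orthogonal innovations;
    -- only the latter has a second moment growing with `N`.
    have h1 : x - T x = X s ω - X (s + N) ω + S := by
      rw [hx, hSdef, map_sum, ← Finset.sum_sub_distrib]
      have h2 : ∀ k ∈ Finset.range N, X (s + (k : ℕ)) ω - T (X (s + (k : ℕ)) ω)
          = (X (s + (k : ℕ)) ω - X (s + ((k + 1 : ℕ) : ℤ)) ω) + ε (s + 1 + (k : ℕ)) ω := by
        intro k _
        have h3 := hω (s + 1 + (k : ℕ))
        rw [show s + 1 + (k : ℤ) - 1 = s + k by ring] at h3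
        rw [show s + ((k + 1 : ℕ) : ℤ) = s + 1 + k by push_cast; ring, h3]
        abel
      rw [Finset.sum_congr rfl h2, Finset.sum_add_distrib,
        Finset.sum_range_sub' (fun k : ℕ => X (s + (k : ℕ)) ω)]
      simp
    have h4 : ‖x‖ ≤ κ * (‖X s ω‖ + ‖X (s + N) ω‖ + ‖S‖) := by
      refine (hκ x).trans ?_
      rw [h1]
      gcongr
      exact (norm_add_le _ _).trans (by gcongr; exact norm_sub_le _ _)
    calc ‖x‖ ^ 2 ≤ (κ * (‖X s ω‖ + ‖X (s + N) ω‖ + ‖S‖)) ^ 2 := by gcongr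
      _ = κ ^ 2 * (‖X s ω‖ + ‖X (s + N) ω‖ + ‖S‖) ^ 2 := by ring
      _ ≤ _ := by
        gcongr
        nlinarith [sq_nonneg (‖X s ω‖ - ‖X (s + N) ω‖), sq_nonneg (‖X s ω‖ - ‖S‖),
          sq_nonneg (‖X (s + N) ω‖ - ‖S‖)]
  have hi1 := h.integrable_norm_sq s
  have hi2 := h.integrable_norm_sq (s + N)
  refine (integral_mono_ae ((memLp_finsetSum _ fun k _ => h.memLp _).integrable_norm_pow
    two_ne_zero) ((((hi1.add hi2).add hS).const_mul 3).const_mul (κ ^ 2)) hle).trans ?_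
  rw [integral_const_mul, integral_const_mul]
  rw [integral_add' (hi1.add hi2) hS, integral_add' hi1 hi2, h.integral_norm_sq s,
    h.integral_norm_sq (s + N), h.integral_norm_sum_innov_sq (s + 1) N, mul_assoc]
  refine mul_le_mul_of_nonneg_left ?_ (sq_nonneg κ)
  have hN : (0 : ℝ) ≤ N := Nat.cast_nonneg N
  rw [← hσ, ← hτ]
  nlinarith [mul_nonneg hσ0 hN]

variable [SecondCountableTopology E]

theorem measurable_inner_mul_inner (e f : E) :
    Measurable fun z : E => inner ℝ z e * inner ℝ z f := by fun_prop

/-- Along each residue class modulo `m` the products are identically distributed and pairwise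
independent, so the classical law applies to each class. -/
theorem tendsto_crossMoment_movingAverage [IsProbabilityMeasure P] (h : IsStationaryAR P T ε X)
    {m : ℕ} (hm : 0 < m) (s : ℤ) (e f : E) :
    Tendsto (fun N : ℕ => (N : ℝ)⁻¹ * ∫ ω, |∑ k ∈ Finset.range N,
      (inner ℝ (movingAverage T ε m (s + (k : ℕ)) ω) e
          * inner ℝ (movingAverage T ε m (s + (k : ℕ)) ω) f
        - ∫ ω, inner ℝ (movingAverage T ε m 0 ω) e * inner ℝ (movingAverage T ε m 0 ω) f ∂P)| ∂P)
      atTop (nhds 0) := by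
  set Z := movingAverage T ε m with hZ
  set c := ∫ ω, inner ℝ (Z 0 ω) e * inner ℝ (Z 0 ω) f ∂P with hc
  have hg := measurable_inner_mul_inner e f
  have hi : ∀ k, Integrable (fun ω => inner ℝ (Z k ω) e * inner ℝ (Z k ω) f) P := fun k =>
    integrable_inner_mul_inner (h.memLp_movingAverage m k) e f
  have hid : ∀ k, IdentDistrib (fun ω => inner ℝ (Z k ω) e * inner ℝ (Z k ω) f)
      (fun ω => inner ℝ (Z 0 ω) e * inner ℝ (Z 0 ω) f) P P := fun k =>
    (h.identDistrib_movingAverage m k).comp hg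
  refine tendsto_integral_abs_average_of_residues
    (fun k ω => inner ℝ (Z (s + (k : ℕ)) ω) e * inner ℝ (Z (s + (k : ℕ)) ω) f - c) hm
    (fun k => (hi _).sub (integrable_const _))
    (K := ∫ ω, |inner ℝ (Z 0 ω) e * inner ℝ (Z 0 ω) f - c| ∂P) (fun k => le_of_eq ?_)
    (fun r _ => ?_)
  · exact ((hid (s + k)).comp (u := fun z => |z - c|) (by fun_prop)).integral_eq
  · have := tendsto_integral_abs_average_of_indep (P := P)
      (fun j ω => inner ℝ (Z (s + ((m * j + r : ℕ) : ℤ)) ω) e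
        * inner ℝ (Z (s + ((m * j + r : ℕ) : ℤ)) ω) f) (hi _) ?_
      (fun k => (hid _).trans (hid _).symm)
    · rw [(hid (s + ((m * 0 + r : ℕ) : ℤ))).integral_eq] at this
      exact this
    · have key : ∀ i j : ℕ, j < i → IndepFun
          (fun ω => inner ℝ (Z (s + ((m * i + r : ℕ) : ℤ)) ω) e
            * inner ℝ (Z (s + ((m * i + r : ℕ) : ℤ)) ω) f)
          (fun ω => inner ℝ (Z (s + ((m * j + r : ℕ) : ℤ)) ω) e
            * inner ℝ (Z (s + ((m * j + r : ℕ) : ℤ)) ω) f) P := by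
        intro i j hij
        refine (h.indepFun_movingAverage ?_).comp hg hg
        have : m * (j + 1) ≤ m * i := Nat.mul_le_mul_left m hij
        rw [mul_add, mul_one] at this
        zify at this
        push_cast
        linarith
      intro i j hij
      rcases lt_or_gt_of_ne hij with hlt | hlt
      · exact (key j i hlt).symm
      · exact key i j hlt

/-- The law of large numbers for the cross moments of the process. -/
theorem tendsto_crossMoment [IsProbabilityMeasure P] (h : IsStationaryAR P T ε X)
    (s : ℤ) (e f : E) :
    Tendsto (fun N : ℕ => ∫ ω, |(N : ℝ)⁻¹ * ∑ k ∈ Finset.range N,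
        inner ℝ (X (s + (k : ℕ)) ω) e * inner ℝ (X (s + (k : ℕ)) ω) f
        - ∫ ω, inner ℝ (X 0 ω) e * inner ℝ (X 0 ω) f ∂P| ∂P) atTop (nhds 0) := by
  set c := ∫ ω, inner ℝ (X 0 ω) e * inner ℝ (X 0 ω) f ∂P with hc
  set σ := ∫ ω, ‖X 0 ω‖ ^ 2 ∂P with hσ
  have hσ0 : 0 ≤ σ := integral_nonneg fun _ => by positivity
  let δ : ℕ → ℝ := fun m => ‖e‖ * ‖f‖ * (2 * ‖T ^ m‖ + ‖T ^ m‖ ^ 2) * σ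
  obtain ⟨k₀, hk₀, hlt⟩ := h.exists_pow_lt
  -- Only `T ^ k₀` is known to be a contraction, so truncation orders are taken among its multiples;
  -- `j + 1` keeps them positive.
  have hpow : Tendsto (fun j : ℕ => ‖T ^ (k₀ * (j + 1))‖) atTop (nhds 0) := by
    refine squeeze_zero (fun _ => norm_nonneg _) (fun j => ?_)
      ((tendsto_pow_atTop_nhds_zero_of_lt_one (norm_nonneg _) hlt).comp (tendsto_add_atTop_nat 1))
    rw [pow_mul]
    exact norm_pow_le' _ (Nat.succ_pos j)
  have hδ : Tendsto (fun j : ℕ => 2 * δ (k₀ * (j + 1))) atTop (nhds 0) := by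
    have h1 := (((hpow.const_mul 2).add (hpow.pow 2)).const_mul (‖e‖ * ‖f‖)).mul_const σ
    simpa [δ] using h1.const_mul 2
  have hU : ∀ k, Integrable (fun ω => inner ℝ (X k ω) e * inner ℝ (X k ω) f) P := fun k =>
    integrable_inner_mul_inner (h.memLp k) e f
  rw [Metric.tendsto_atTop]
  intro η hη
  obtain ⟨j, hj⟩ := (hδ.eventually_lt_const (half_pos hη)).exists
  set m := k₀ * (j + 1) with hm
  have hm0 : 0 < m := Nat.mul_pos hk₀ (Nat.succ_pos j)
  set Z := movingAverage T ε m with hZ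
  set c' := ∫ ω, inner ℝ (Z 0 ω) e * inner ℝ (Z 0 ω) f ∂P with hc'
  have hW : ∀ k, Integrable (fun ω => inner ℝ (Z k ω) e * inner ℝ (Z k ω) f) P := fun k =>
    integrable_inner_mul_inner (h.memLp_movingAverage m k) e f
  -- The truncation error does not depend on `k`. It enters twice, in the average and in the limit,
  -- hence the choice `2 * δ m < η / 2`.
  have hdiff : ∀ k, ∫ ω, |inner ℝ (X k ω) e * inner ℝ (X k ω) f
      - inner ℝ (Z k ω) e * inner ℝ (Z k ω) f| ∂P ≤ δ m := fun k =>
    h.integral_abs_crossMoment_sub_le m k e f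
  have hcc : |c' - c| ≤ δ m := by
    rw [hc, hc', abs_sub_comm, ← integral_sub (hU 0) (hW 0)]
    exact (abs_integral_le_integral_abs).trans (hdiff 0)
  have hlim := h.tendsto_crossMoment_movingAverage hm0 s e f
  obtain ⟨N₀, hN₀⟩ := eventually_atTop.1 (hlim.eventually_lt_const (half_pos hη))
  refine ⟨N₀ + 1, fun N hN => ?_⟩
  have hNpos : (0 : ℝ) < N := by
    have : 0 < N := by omega
    exact_mod_cast this
  rw [Real.dist_0_eq_abs, abs_of_nonneg (integral_nonneg fun _ => abs_nonneg _)]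
  have hA : Integrable (fun ω => (N : ℝ)⁻¹ * |∑ k ∈ Finset.range N,
      (inner ℝ (Z (s + (k : ℕ)) ω) e * inner ℝ (Z (s + (k : ℕ)) ω) f - c')|) P :=
    (integrable_finsetSum _ fun k _ => (hW _).sub (integrable_const _)).abs.const_mul _
  have hD : ∀ k, Integrable (fun ω => |inner ℝ (X k ω) e * inner ℝ (X k ω) f
      - inner ℝ (Z k ω) e * inner ℝ (Z k ω) f|) P := fun k => ((hU k).sub (hW k)).abs
  have hB : Integrable (fun ω => (N : ℝ)⁻¹ * ∑ k ∈ Finset.range N,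
      |inner ℝ (X (s + (k : ℕ)) ω) e * inner ℝ (X (s + (k : ℕ)) ω) f
        - inner ℝ (Z (s + (k : ℕ)) ω) e * inner ℝ (Z (s + (k : ℕ)) ω) f|) P :=
    (integrable_finsetSum _ fun k _ => hD _).const_mul _
  have hpt : ∀ ω, |(N : ℝ)⁻¹ * ∑ k ∈ Finset.range N,
        inner ℝ (X (s + (k : ℕ)) ω) e * inner ℝ (X (s + (k : ℕ)) ω) f - c|
      ≤ ((N : ℝ)⁻¹ * |∑ k ∈ Finset.range N,
          (inner ℝ (Z (s + (k : ℕ)) ω) e * inner ℝ (Z (s + (k : ℕ)) ω) f - c')|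
        + (N : ℝ)⁻¹ * ∑ k ∈ Finset.range N,
          |inner ℝ (X (s + (k : ℕ)) ω) e * inner ℝ (X (s + (k : ℕ)) ω) f
          - inner ℝ (Z (s + (k : ℕ)) ω) e * inner ℝ (Z (s + (k : ℕ)) ω) f|) + |c' - c| := by
    intro ω
    have h1 : (N : ℝ)⁻¹ * ∑ k ∈ Finset.range N,
        inner ℝ (X (s + (k : ℕ)) ω) e * inner ℝ (X (s + (k : ℕ)) ω) f - c
        = ((N : ℝ)⁻¹ * (∑ k ∈ Finset.range N,
          (inner ℝ (Z (s + (k : ℕ)) ω) e * inner ℝ (Z (s + (k : ℕ)) ω) f - c'))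
        + (N : ℝ)⁻¹ * ∑ k ∈ Finset.range N,
          (inner ℝ (X (s + (k : ℕ)) ω) e * inner ℝ (X (s + (k : ℕ)) ω) f
          - inner ℝ (Z (s + (k : ℕ)) ω) e * inner ℝ (Z (s + (k : ℕ)) ω) f)) + (c' - c) := by
      simp only [Finset.sum_sub_distrib, Finset.sum_const, Finset.card_range, nsmul_eq_mul]
      field_simp
      ring
    rw [h1]
    refine (abs_add_le _ _).trans (add_le_add ((abs_add_le _ _).trans (add_le_add ?_ ?_)) le_rfl)
    · rw [abs_mul, abs_of_nonneg (by positivity : (0 : ℝ) ≤ (N : ℝ)⁻¹)]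
    · rw [abs_mul, abs_of_nonneg (by positivity : (0 : ℝ) ≤ (N : ℝ)⁻¹)]
      gcongr
      exact Finset.abs_sum_le_sum_abs _ _
  have hI := integral_mono
    ((integrable_finsetSum _ fun k _ => hU _).const_mul _ |>.sub (integrable_const c) |>.abs)
    ((hA.add hB).add (integrable_const |c' - c|)) hpt
  refine hI.trans_lt ?_
  rw [integral_add' (hA.add hB) (integrable_const _), integral_add' hA hB, integral_const_mul,
    integral_const_mul, integral_finsetSum _ fun k _ => hD _]
  simp only [integral_const, probReal_univ, one_smul]
  have h1 := hN₀ N (by omega)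
  have h2 : (N : ℝ)⁻¹ * ∑ k ∈ Finset.range N, ∫ ω,
      |inner ℝ (X (s + (k : ℕ)) ω) e * inner ℝ (X (s + (k : ℕ)) ω) f
        - inner ℝ (Z (s + (k : ℕ)) ω) e * inner ℝ (Z (s + (k : ℕ)) ω) f| ∂P ≤ δ m := by
    rw [inv_mul_le_iff₀ hNpos]
    calc _ ≤ ∑ k ∈ Finset.range N, δ m := Finset.sum_le_sum fun k _ => hdiff _
      _ = _ := by simp
  linarith

end IsStationaryAR

end Moments

/-! ### Rank dichotomy for the population second moment. -/

section Population

variable {Ω : Type*} [MeasurableSpace Ω] {E : Type*} [NormedAddCommGroup E]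
  [InnerProductSpace ℝ E] {P : Measure Ω}

/-- The second moment form `(x, y) ↦ E⟨Z, x⟩⟨Z, y⟩` of a square integrable random vector. -/
def momentForm {Z : Ω → E} (hZ : MemLp Z 2 P) : E →ₗ[ℝ] E →ₗ[ℝ] ℝ :=
  LinearMap.mk₂ ℝ (fun x y => ∫ ω, inner ℝ (Z ω) x * inner ℝ (Z ω) y ∂P)
    (fun x x' y => by
      rw [← integral_add (integrable_inner_mul_inner hZ x y) (integrable_inner_mul_inner hZ x' y)]
      simp only [inner_add_right, add_mul])
    (fun c x y => by
      rw [smul_eq_mul, ← integral_const_mul]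
      simp only [inner_smul_right, mul_assoc])
    (fun x y y' => by
      rw [← integral_add (integrable_inner_mul_inner hZ x y) (integrable_inner_mul_inner hZ x y')]
      simp only [inner_add_right, mul_add])
    (fun c x y => by
      rw [smul_eq_mul, ← integral_const_mul]
      simp only [inner_smul_right, mul_left_comm])

theorem momentForm_apply {Z : Ω → E} (hZ : MemLp Z 2 P) (x y : E) :
    momentForm hZ x y = ∫ ω, inner ℝ (Z ω) x * inner ℝ (Z ω) y ∂P := rfl

theorem momentForm_comm {Z : Ω → E} (hZ : MemLp Z 2 P) (x y : E) :
    momentForm hZ x y = momentForm hZ y x := by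
  simp only [momentForm_apply, mul_comm]

/-- Either there are `d` directions along which the second moment form of a random vector is the
identity, or there are `r < d` of them and the vector lies in an `r`-dimensional space. -/
theorem exists_orthonormal_momentForm [CompleteSpace E] [SecondCountableTopology E]
    [IsFiniteMeasure P] {Z : Ω → E} (hZ : MemLp Z 2 P) (d : ℕ) :
    ∃ r ≤ d, ∃ e : Fin r → E, (∀ i j, momentForm hZ (e i) (e j) = if i = j then 1 else 0) ∧
      (r = d ∨ ∃ f : Fin r → E, ∀ᵐ ω ∂P, Z ω ∈ Submodule.span ℝ (Set.range f)) := by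
  classical
  let S : ℕ → Prop := fun r =>
    ∃ e : Fin r → E, ∀ i j, momentForm hZ (e i) (e j) = if i = j then 1 else 0
  have hS0 : S 0 := ⟨Fin.elim0, fun i => i.elim0⟩
  -- A maximal family plays the role of a spectral decomposition: if `r < d`, Gram-Schmidt cannot
  -- produce another direction.
  set r := Nat.findGreatest S d with hr
  have hrd : r ≤ d := Nat.findGreatest_le d
  obtain ⟨e, he⟩ : S r := Nat.findGreatest_spec (Nat.zero_le d) hS0
  refine ⟨r, hrd, e, he, ?_⟩
  rcases hrd.eq_or_lt with h | hlt
  · exact Or.inl h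
  right
  have hmax : ¬ S (r + 1) := Nat.findGreatest_is_greatest (Nat.lt_succ_self r) hlt
  let f : Fin r → E := fun i => ∫ ω, inner ℝ (Z ω) (e i) • Z ω ∂P
  have hfi : ∀ i, Integrable (fun ω => inner ℝ (Z ω) (e i) • Z ω) P := by
    intro i
    exact memLp_one_iff_integrable.1 (hZ.smul (hZ.inner_const (e i)))
  have hf : ∀ i x, inner ℝ x (f i) = momentForm hZ x (e i) := by
    intro i x
    rw [← integral_inner (hfi i), momentForm_apply]
    refine integral_congr_ae (Eventually.of_forall fun ω => ?_)
    simp only [inner_smul_right, real_inner_comm x]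
    ring
  have hres : ∀ x, ∀ᵐ ω ∂P, inner ℝ (Z ω) (x - ∑ i, momentForm hZ x (e i) • e i) = 0 := by
    intro x
    set x' := x - ∑ i, momentForm hZ x (e i) • e i with hx'
    have h1 : ∀ j, momentForm hZ x' (e j) = 0 := by
      intro j
      simp [hx', LinearMap.sum_apply, he]
    -- Otherwise `x'`, normalised, would extend the family to `r + 1` directions.
    have h2 : momentForm hZ x' x' = 0 := by
      by_contra hne
      have hpos : 0 < momentForm hZ x' x' :=
        lt_of_le_of_ne (integral_nonneg fun ω => mul_self_nonneg _) (Ne.symm hne)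
      refine hmax ⟨Fin.cons ((√(momentForm hZ x' x'))⁻¹ • x') e, fun i j => ?_⟩
      refine Fin.cases ?_ (fun i => ?_) i <;> refine Fin.cases ?_ (fun j => ?_) j
      · simp only [Fin.cons_zero, map_smul, LinearMap.smul_apply, smul_eq_mul, if_true]
        rw [← mul_assoc, ← mul_inv, Real.mul_self_sqrt hpos.le, inv_mul_cancel₀ hne]
      · simp [h1, (Fin.succ_ne_zero j).symm]
      · simp [momentForm_comm hZ (e i), h1, Fin.succ_ne_zero i]
      · simp [he, Fin.succ_inj]
    rw [momentForm_apply, integral_eq_zero_iff_of_nonneg (fun ω => mul_self_nonneg _)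
      (integrable_inner_mul_inner hZ _ _)] at h2
    filter_upwards [h2] with ω hω
    exact mul_self_eq_zero.1 hω
  -- Each test vector has its own null set; separability of `E` merges them into one.
  have hzero : (fun ω => Z ω - ∑ i, inner ℝ (Z ω) (e i) • f i) =ᵐ[P] 0 := by
    refine ae_eq_zero_of_forall_inner (𝕜 := ℝ) fun x => ?_
    filter_upwards [hres x] with ω hω
    rw [inner_sub_right, inner_sum, sub_eq_zero] at hω
    simp only [inner_smul_right] at hω
    rw [inner_sub_right, inner_sum, real_inner_comm, hω]
    simp only [inner_smul_right, hf, Pi.zero_apply, sub_eq_zero]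
    exact Finset.sum_congr rfl fun i _ => mul_comm _ _
  refine ⟨f, ?_⟩
  filter_upwards [hzero] with ω hω
  rw [sub_eq_zero.1 hω]
  exact Submodule.sum_mem _ fun i _ =>
    Submodule.smul_mem _ _ (Submodule.subset_span (Set.mem_range_self i))

end Population

/-! ### Probability bounds and the rate in a general Hilbert space. -/

section Asymptotics

theorem sum_Icc_eq_sum_range {G : Type*} [AddCommMonoid G] (F : ℤ → G) (a b : ℤ) :
    ∑ k ∈ Finset.Icc a b, F k = ∑ j ∈ Finset.range (b - a + 1).toNat, F (a + (j : ℕ)) := by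
  symm
  refine Finset.sum_bij' (fun j _ => a + (j : ℤ)) (fun k _ => (k - a).toNat) ?_ ?_ ?_ ?_ ?_
  · intro j hj; simp only [Finset.mem_Icc, Finset.mem_range] at *; omega
  · intro k hk; simp only [Finset.mem_Icc, Finset.mem_range] at *; omega
  · intro j _; simp
  · intro k hk; simp only [Finset.mem_Icc] at hk; omega
  · intro j _; rfl

variable {Ω : Type*} [MeasurableSpace Ω] {P : Measure Ω}

/-- Markov's inequality. -/
theorem measure_le_ofReal_of_integral_le [IsFiniteMeasure P] {f : Ω → ℝ} (hf : ∀ ω, 0 ≤ f ω)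
    (hi : Integrable f P) {t η : ℝ} (ht : 0 < t) (h : ∫ ω, f ω ∂P ≤ t * η) :
    P {ω | t ≤ f ω} ≤ ENNReal.ofReal η := by
  have h1 := mul_meas_ge_le_integral_of_nonneg (Eventually.of_forall hf) hi t
  rw [← ofReal_measureReal]
  exact ENNReal.ofReal_le_ofReal (le_of_mul_le_mul_left (h1.trans h) ht)

variable {E : Type*} [NormedAddCommGroup E] [InnerProductSpace ℝ E] [MeasurableSpace E]
  [BorelSpace E] [SecondCountableTopology E] [CompleteSpace E] [IsProbabilityMeasure P]

set_option maxHeartbeats 800000 in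
/-- For a stationary autoregressive process of order one in a Hilbert space, the least squares
predictor and Bosq's predictor differ by `O_P(1/n)`. -/
theorem IsStationaryAR.isBigOP_varPredictor_sub_bosqPredictor {T : E →L[ℝ] E} {ε X : ℤ → Ω → E}
    (h : IsStationaryAR P T ε X) (s : ℤ) (m : ℕ → Ω → E)
    (hm : (∀ n ω, m n ω = 0) ∨ (∀ n ω, m n ω = sampleMean (fun k => X k ω) s n))
    (d : ℕ) (lam : ℕ → Ω → Fin d → ℝ) (v : ℕ → Ω → Fin d → E)
    (hv : ∀ n ω, IsLeadingEigensystem (sampleCov (m n ω) (fun k => X k ω) s n)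
      (lam n ω) (v n ω))
    (B : ℕ → Ω → Matrix (Fin d) (Fin d) ℝ)
    (hB : ∀ n ω, IsOLS (v n ω) (fun k => X k ω) s n (B n ω)) :
    IsBigOP P
      (fun n ω => ‖varPredictor (v n ω) (fun k => X k ω) n (B n ω)
          - bosqPredictor (lam n ω) (v n ω) (fun k => X k ω) s n‖)
      (fun n => 1 / (n : ℝ)) := by
  intro η hη
  obtain ⟨r, hrd, e, he, hspan⟩ := exists_orthonormal_momentForm (h.memLp 0) d
  obtain ⟨K, hK0, hK⟩ := h.exists_integral_norm_sum_sq_le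
  set σ := ∫ ω, ‖X 0 ω‖ ^ 2 ∂P with hσ
  have hσ0 : 0 ≤ σ := integral_nonneg fun _ => by positivity
  set L := ∑ i, ‖e i‖ ^ 2 with hL
  have hL0 : 0 ≤ L := Finset.sum_nonneg fun _ _ => sq_nonneg _
  set c := 1 / (2 * (L + 1)) with hc
  have hc0 : 0 < c := by positivity
  -- Chosen so that Markov's inequality gives each of three moment events probability at most `η /
  -- 4`; `8 * K` rather than `4 * K` because `K * (N + 1) ≤ 2 * K * N`.
  set M := (4 * σ + 8 * K) / η + 1 with hM
  have hM0 : 0 < M := by positivity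
  have hMη : M * (η / 4) = σ + 2 * K + η / 4 := by rw [hM]; field_simp; ring
  set K₁ := (4 * M * c⁻¹) * ((1 + 2 * M * c⁻¹) * √M) with hK₁
  have hK₁0 : 0 ≤ K₁ := by positivity
  -- Half of the tolerance `1 / (2 * (r + 1))` for the Gram matrix; the centring term takes the
  -- other half.
  set θ : ℝ := 1 / (4 * (r + 1)) with hθ
  have hθ0 : 0 < θ := by positivity
  let N : ℕ → ℕ := fun n => ((n : ℤ) - s + 1).toNat
  have hNtop : Tendsto N atTop atTop := by
    refine tendsto_atTop.2 fun k => ?_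
    filter_upwards [eventually_ge_atTop (k + s.natAbs)] with n hn
    simp only [N]; omega
  let D : ℕ → Ω → ℝ := fun n ω => ∑ i, ∑ j, |(n : ℝ)⁻¹ * ∑ k ∈ Finset.range n,
        inner ℝ (X (s + (k : ℕ)) ω) (e i) * inner ℝ (X (s + (k : ℕ)) ω) (e j)
        - if i = j then 1 else 0|
  have hDi : ∀ n : ℕ, ∀ i j, Integrable (fun ω => |(n : ℝ)⁻¹ * ∑ k ∈ Finset.range n,
        inner ℝ (X (s + (k : ℕ)) ω) (e i) * inner ℝ (X (s + (k : ℕ)) ω) (e j)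
        - if i = j then 1 else 0|) P := fun n i j =>
    ((integrable_finsetSum _ fun k _ => integrable_inner_mul_inner (h.memLp _) _ _).const_mul _
      |>.sub (integrable_const _)).abs
  have hDint : ∀ n, Integrable (D n) P := fun n =>
    integrable_finsetSum _ fun i _ => integrable_finsetSum _ fun j _ => hDi n i j
  have hDlim : Tendsto (fun n => ∫ ω, D n ω ∂P) atTop (nhds 0) := by
    have h1 : ∀ n : ℕ, ∫ ω, D n ω ∂P = ∑ i, ∑ j, ∫ ω, |(n : ℝ)⁻¹ * ∑ k ∈ Finset.range n,
        inner ℝ (X (s + (k : ℕ)) ω) (e i) * inner ℝ (X (s + (k : ℕ)) ω) (e j)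
        - if i = j then 1 else 0| ∂P := by
      intro n
      simp only [D]
      rw [integral_finsetSum _ fun i _ => integrable_finsetSum _ fun j _ => hDi n i j]
      exact Finset.sum_congr rfl fun i _ => integral_finsetSum _ fun j _ => hDi n i j
    simp only [h1]
    have h2 : (∑ _i : Fin r, ∑ _j : Fin r, (0 : ℝ)) = 0 := by simp
    refine Eq.subst (motive := fun z => Tendsto _ _ (nhds z)) h2 ?_
    refine tendsto_finsetSum _ fun i _ => tendsto_finsetSum _ fun j _ => ?_
    have h3 := h.tendsto_crossMoment s (e i) (e j)
    rw [← momentForm_apply (h.memLp 0), he] at h3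
    exact h3
  have hspanX : ∀ᵐ ω ∂P, r = d ∨ ∃ f : Fin r → E, ∀ k, X k ω ∈ Submodule.span ℝ (Set.range f) := by
    rcases hspan with hrd | ⟨f, hf⟩
    · exact Eventually.of_forall fun _ => Or.inl hrd
    · have : FiniteDimensional ℝ (Submodule.span ℝ (Set.range f)) :=
        FiniteDimensional.span_of_finite ℝ (Set.finite_range f)
      have hcl : MeasurableSet {z : E | z ∈ Submodule.span ℝ (Set.range f)} :=
        (Submodule.closed_of_finiteDimensional (Submodule.span ℝ (Set.range f))).measurableSet
      have h1 : ∀ k, ∀ᵐ ω ∂P, X k ω ∈ Submodule.span ℝ (Set.range f) := fun k =>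
        (h.identDistrib k).symm.ae_snd hcl hf
      filter_upwards [ae_all_iff.2 h1] with ω hω
      exact Or.inr ⟨f, hω⟩
  -- The deterministic bound is `K₁ / (n - s)`, and `n ≤ 2 * (n - s)` for large `n`.
  refine ⟨2 * K₁, ?_⟩
  have hDev : ∀ᶠ n : ℕ in atTop, ∫ ω, D (N n) ω ∂P ≤ θ * (η / 4) :=
    ((hDlim.comp hNtop).eventually_lt_const (by positivity)).mono fun _ => le_of_lt
  have hlarge : ∀ᶠ n : ℕ in atTop, M * L / θ + 2 * (1 + 2 * M * c⁻¹) + 1 ≤ ((N n : ℕ) : ℝ) :=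
    (tendsto_natCast_atTop_atTop.comp hNtop).eventually_ge_atTop _
  filter_upwards [hDev, hlarge, eventually_ge_atTop (2 * s.natAbs + 1)] with n hn1 hn2 hn3
  have hsn : s + 1 ≤ (n : ℤ) := by omega
  have hNn : (((n : ℤ) - s + 1 : ℤ) : ℝ) = (N n : ℝ) := by
    have : ((N n : ℕ) : ℤ) = (n : ℤ) - s + 1 := by simp only [N]; omega
    exact_mod_cast this.symm
  have hn0 : (((n : ℤ) - s : ℤ) : ℝ) = (N n : ℝ) - 1 := by
    rw [← hNn]; push_cast; ring
  have hN1 : (1 : ℝ) ≤ N n := by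
    have : 1 ≤ N n := by simp only [N]; omega
    exact_mod_cast this
  have hN0 : (0 : ℝ) < N n := by linarith
  have hA := measure_le_ofReal_of_integral_le (P := P) (f := fun ω => ‖X n ω‖ ^ 2)
    (fun ω => by positivity) (h.integrable_norm_sq n) (η := η / 4) hM0
    (by rw [h.integral_norm_sq, hMη]; linarith)
  have hBd := measure_le_ofReal_of_integral_le (P := P)
    (f := fun ω => ∑ k ∈ Finset.range (N n), ‖X (s + (k : ℕ)) ω‖ ^ 2)
    (fun ω => by positivity) (integrable_finsetSum _ fun k _ => h.integrable_norm_sq _)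
    (η := η / 4) (mul_pos hN0 hM0) (by
      rw [integral_finsetSum _ fun k _ => h.integrable_norm_sq _]
      simp only [h.integral_norm_sq]
      rw [Finset.sum_const, Finset.card_range, nsmul_eq_mul, mul_assoc, hMη]
      gcongr
      linarith)
  have hC := measure_le_ofReal_of_integral_le (P := P)
    (f := fun ω => ‖∑ k ∈ Finset.range (N n), X (s + (k : ℕ)) ω‖ ^ 2)
    (fun ω => by positivity)
    ((memLp_finsetSum _ fun k _ => h.memLp _).integrable_norm_pow two_ne_zero)
    (η := η / 4) (mul_pos hN0 hM0) ((hK s (N n)).trans (by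
      rw [mul_assoc, hMη]
      nlinarith))
  have hDm := measure_le_ofReal_of_integral_le (P := P) (f := D (N n))
    (fun ω => Finset.sum_nonneg fun _ _ => Finset.sum_nonneg fun _ _ => abs_nonneg _)
    (hDint _) hθ0 hn1
  have hnull : P {ω | ¬ (r = d ∨ ∃ f : Fin r → E,
    ∀ k, X k ω ∈ Submodule.span ℝ (Set.range f))} = 0 := hspanX
  -- Eigenvectors and least squares matrices are chosen without measurability. The inclusion into
  -- events defined from `X` alone makes monotonicity of the outer measure sufficient.
  have hsub : {ω | 2 * K₁ * (1 / (n : ℝ)) < |‖varPredictor (v n ω) (fun k => X k ω) n (B n ω)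
          - bosqPredictor (lam n ω) (v n ω) (fun k => X k ω) s n‖|}
      ⊆ (({ω | M ≤ ‖X n ω‖ ^ 2}
          ∪ {ω | N n * M ≤ ∑ k ∈ Finset.range (N n), ‖X (s + (k : ℕ)) ω‖ ^ 2})
        ∪ ({ω | N n * M ≤ ‖∑ k ∈ Finset.range (N n), X (s + (k : ℕ)) ω‖ ^ 2}
          ∪ {ω | θ ≤ D (N n) ω}))
        ∪ {ω | ¬ (r = d ∨ ∃ f : Fin r → E,
            ∀ k, X k ω ∈ Submodule.span ℝ (Set.range f))} := by
    intro ω hω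
    by_contra hgood
    simp only [Set.mem_union, Set.mem_ofPred_eq, not_or, not_le] at hgood
    obtain ⟨⟨⟨hg1, hg2⟩, hg3, hg4⟩, hg5⟩ := hgood
    refine (Set.mem_ofPred_eq ▸ hω : 2 * K₁ * (1 / (n : ℝ)) < _).not_ge ?_
    rw [abs_norm]
    have hmω : m n ω = 0 ∨ m n ω = sampleMean (fun k => X k ω) s n :=
      hm.imp (fun h => h n ω) (fun h => h n ω)
    have hmM : (N n : ℝ) * ‖m n ω‖ ^ 2 ≤ M := by
      rcases hmω with h0 | h0
      · rw [h0]; simpa using hM0.le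
      · rw [h0, sampleMean, hNn, sum_Icc_eq_sum_range, norm_smul, mul_pow,
          Real.norm_of_nonneg (by positivity)]
        calc _ = (N n : ℝ)⁻¹ * ‖∑ k ∈ Finset.range (N n), X (s + (k : ℕ)) ω‖ ^ 2 := by
              field_simp
              rfl
          _ ≤ (N n : ℝ)⁻¹ * (N n * M) := by gcongr
          _ = M := by field_simp
    have hG : ∀ i j, |inner ℝ (sampleCov (m n ω) (fun k => X k ω) s n (e i)) (e j)
        - if i = j then 1 else 0| ≤ 1 / (2 * (r + 1)) := by
      intro i j
      rw [inner_sampleCov (by omega) hmω, hNn, sum_Icc_eq_sum_range]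
      have h1 : |(N n : ℝ)⁻¹ * ∑ k ∈ Finset.range (N n),
          inner ℝ (X (s + (k : ℕ)) ω) (e i) * inner ℝ (X (s + (k : ℕ)) ω) (e j)
          - if i = j then 1 else 0| ≤ θ := by
        refine le_trans ?_ hg4.le
        refine le_trans (Finset.single_le_sum (f := fun j => |(N n : ℝ)⁻¹ *
          ∑ k ∈ Finset.range (N n),
          inner ℝ (X (s + (k : ℕ)) ω) (e i) * inner ℝ (X (s + (k : ℕ)) ω) (e j)
          - if i = j then 1 else 0|) (fun _ _ => abs_nonneg _) (Finset.mem_univ j)) ?_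
        exact Finset.single_le_sum (f := fun i => ∑ j, |(N n : ℝ)⁻¹ *
          ∑ k ∈ Finset.range (N n),
          inner ℝ (X (s + (k : ℕ)) ω) (e i) * inner ℝ (X (s + (k : ℕ)) ω) (e j)
          - if i = j then 1 else 0|)
          (fun _ _ => Finset.sum_nonneg fun _ _ => abs_nonneg _) (Finset.mem_univ i)
      have h2 : |inner ℝ (m n ω) (e i) * inner ℝ (m n ω) (e j)| ≤ θ := by
        have h3 : ∀ i, ‖e i‖ ^ 2 ≤ L := fun i =>
          Finset.single_le_sum (f := fun i => ‖e i‖ ^ 2) (fun _ _ => sq_nonneg _)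
            (Finset.mem_univ i)
        have h4 : ‖e i‖ * ‖e j‖ ≤ L := by
          nlinarith [h3 i, h3 j, sq_nonneg (‖e i‖ - ‖e j‖)]
        have h5 : M * L ≤ θ * N n := by
          have : M * L / θ ≤ N n := by
            have : 0 ≤ 2 * (1 + 2 * M * c⁻¹) := by positivity
            linarith
          rwa [div_le_iff₀' hθ0] at this
        rw [abs_mul]
        calc _ ≤ (‖m n ω‖ * ‖e i‖) * (‖m n ω‖ * ‖e j‖) :=
              mul_le_mul (abs_real_inner_le_norm _ _) (abs_real_inner_le_norm _ _)
                (abs_nonneg _) (by positivity)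
          _ = ‖m n ω‖ ^ 2 * (‖e i‖ * ‖e j‖) := by ring
          _ ≤ (M / N n) * L := by
              gcongr
              rwa [le_div_iff₀' hN0]
          _ ≤ θ := by
              rw [div_mul_eq_mul_div, div_le_iff₀ hN0]
              exact h5
      have h6 : (1 : ℝ) / (2 * (r + 1)) = θ + θ := by rw [hθ]; field_simp; norm_num
      rw [h6, sub_right_comm]
      exact (abs_sub _ _).trans (add_le_add h1 h2)
    have hlam := (hv n ω).le_or_inner_eq_zero hmω hrd e hG
      ((or_iff_not_and_not.2 hg5).imp_right fun ⟨f, hf⟩ => ⟨f, fun k _ => hf k⟩)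
    have hmain := norm_varPredictor_sub_bosqPredictor_le hc0 hM0.le hsn hmω (hv n ω) (hB n ω)
      hlam (by rw [hNn]; exact hmM) hg1.le
      (by rw [hNn, sum_Icc_eq_sum_range]; exact hg2.le)
      (by
        rw [hn0]
        have : 0 ≤ M * L / θ := by positivity
        linarith)
    refine hmain.trans ?_
    have hn4 : (0 : ℝ) < n := by
      have : 0 < n := by omega
      exact_mod_cast this
    have hn5 : (n : ℝ) ≤ 2 * (((n : ℤ) - s : ℤ) : ℝ) := by
      have : (n : ℤ) ≤ 2 * ((n : ℤ) - s) := by omega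
      exact_mod_cast this
    rw [mul_one_div, div_le_div_iff₀ (by linarith) hn4]
    exact (mul_le_mul_of_nonneg_left hn5 hK₁0).trans (le_of_eq (by ring))
  have hη4 : ENNReal.ofReal η = (ENNReal.ofReal (η / 4) + ENNReal.ofReal (η / 4))
      + (ENNReal.ofReal (η / 4) + ENNReal.ofReal (η / 4)) := by
    rw [← ENNReal.ofReal_add (by positivity) (by positivity),
      ← ENNReal.ofReal_add (by positivity) (by positivity)]
    congr 1; ring
  calc _ ≤ _ := measure_mono hsub
    _ ≤ _ := measure_union_le _ _
    _ ≤ _ := by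
      rw [hnull, add_zero, hη4]
      exact (measure_union_le _ _).trans (add_le_add
        ((measure_union_le _ _).trans (add_le_add hA hBd))
        ((measure_union_le _ _).trans (add_le_add hC hDm)))

end Asymptotics

/-! ### Reduction of the functional autoregression to first order, and conclusion. -/

section StateSpace

instance : SecondCountableTopology H :=
  have : Fact ((2 : ENNReal) ≠ ⊤) := ⟨ENNReal.ofNat_ne_top⟩
  Lp.SecondCountableTopology

/-- The embedding of `H` into `H_p` as the first coordinate. -/
def firstCoord (p : ℕ) : H →L[ℝ] Hp p :=
  ((PiLp.continuousLinearEquiv 2 ℝ (fun _ : Fin p => H)).symm :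
      (Fin p → H) →L[ℝ] Hp p).comp
    (ContinuousLinearMap.pi fun i : Fin p =>
      if i.val = 0 then ContinuousLinearMap.id ℝ H else 0)

theorem firstCoord_apply (p : ℕ) (z : H) (i : Fin p) :
    firstCoord p z i = if i.val = 0 then z else 0 := by
  simp only [firstCoord, ContinuousLinearMap.comp_apply]
  change (if i.val = 0 then ContinuousLinearMap.id ℝ H else 0) z = _
  split_ifs <;> rfl

theorem companion_apply {p : ℕ} (Ψ : Fin p → H →L[ℝ] H) (x : Hp p) (i : Fin p) :
    companion Ψ x i = if i.val = 0 then ∑ j, Ψ j (x j)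
      else x ⟨i.val - 1, lt_of_le_of_lt (Nat.sub_le i.val 1) i.isLt⟩ := by
  simp only [companion, ContinuousLinearMap.comp_apply]
  change (if i.val = 0 then ∑ j : Fin p, (Ψ j).comp (PiLp.proj 2 (fun _ : Fin p => H) j)
    else PiLp.proj 2 (fun _ : Fin p => H)
      ⟨i.val - 1, lt_of_le_of_lt (Nat.sub_le i.val 1) i.isLt⟩) x = _
  split_ifs
  · simp [sum_apply]
  · rfl

theorem measurable_stateVector (p : ℕ) (k : ℤ) :
    Measurable fun y : ℤ → H => stateVector p y k := by
  refine (WithLp.measurable_toLp 2 (Fin p → H)).comp ?_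
  exact measurable_pi_lambda _ fun j => measurable_pi_apply _

variable {Ω : Type*} [MeasurableSpace Ω] {P : Measure Ω}

/-- The state vectors of a functional autoregression form an autoregression of order one. -/
theorem IsStationaryCausalSolution.isStationaryAR [IsProbabilityMeasure P] {p : ℕ}
    {Ψ : Fin p → H →L[ℝ] H} {ε Y : ℤ → Ω → H} (hε : IsInnovation P ε)
    (hY : IsStationaryCausalSolution P Ψ ε Y)
    (hΨ : ∃ k₀ : ℕ, 1 ≤ k₀ ∧ ‖(companion Ψ) ^ k₀‖ < 1) :
    IsStationaryAR P (companion Ψ) (fun k ω => firstCoord p (ε k ω))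
      (fun k ω => stateVector p (fun i => Y i ω) k) where
  measurable_innov k := (firstCoord p).measurable.comp (hε.measurable k)
  indep := hε.indep.comp (fun _ => firstCoord p) fun _ => (firstCoord p).measurable
  identDistrib_innov k := (hε.identDistrib k).comp (firstCoord p).measurable
  memLp_innov k := (firstCoord p).comp_memLp' (hε.memLp k)
  centred k := by
    rw [(firstCoord p).integral_comp_comm ((hε.memLp k).integrable one_le_two), hε.centred,
      map_zero]
  measurable k := (measurable_stateVector p k).comp (measurable_pi_lambda _ hY.measurable)
  memLp k := MemLp.of_eval_piLp fun j => hY.memLp (k - (j.val : ℤ))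
  recursion k := by
    filter_upwards [hY.recursion k] with ω hω
    ext1 i
    rw [PiLp.add_apply, companion_apply, firstCoord_apply]
    split_ifs with hi
    · change Y (k - (i.val : ℤ)) ω = ∑ j, Ψ j (Y (k - 1 - (j.val : ℤ)) ω) + ε k ω
      rw [hi, Nat.cast_zero, sub_zero, hω]
      congr 1
      refine Finset.sum_congr rfl fun j _ => ?_
      rw [sub_sub, add_comm (1 : ℤ)]
    · change Y (k - (i.val : ℤ)) ω = Y (k - 1 - ((i.val - 1 : ℕ) : ℤ)) ω + 0
      rw [add_zero]
      congr 1
      omega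
  identDistrib_pair k l := by
    -- The pair at times `k` and `k - l` is the map reading the state at times `0` and `-l`, applied
    -- to the path shifted by `k`.
    have h1 := (hY.stationary k).comp
      ((measurable_stateVector p 0).prodMk (measurable_stateVector p (0 - l)))
    have h2 : ∀ (y : ℤ → H) (j : ℤ), stateVector p (fun i => y (i + k)) j
        = stateVector p y (k + j) := by
      intro y j
      simp only [stateVector]
      congr 1
      ext1 i
      congr 1
      ring
    convert h1 using 1
    swap
    · rfl
    ext1 ω
    simp only [Function.comp_apply]
    rw [h2 (fun i => Y i ω), h2 (fun i => Y i ω), add_zero, zero_sub, sub_eq_add_neg]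
  exists_pow_lt := hΨ

end StateSpace

theorem IsBigOP.mono {Ω : Type*} [MeasurableSpace Ω] {P : Measure Ω} {Z W : ℕ → Ω → ℝ}
    {a : ℕ → ℝ} (hW : IsBigOP P W a) (h : ∀ n ω, |Z n ω| ≤ |W n ω|) : IsBigOP P Z a := by
  intro η hη
  obtain ⟨M, hM⟩ := hW η hη
  refine ⟨M, hM.mono fun n hn => (measure_mono fun ω hω => ?_).trans hn⟩
  exact lt_of_lt_of_le hω (h n ω)

end FunctionalAR

end

theorem mainTheorem2 {Ω : Type*} [MeasurableSpace Ω] (P : Measure Ω) [IsProbabilityMeasure P]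
    (p : ℕ) (hp : 0 < p) (Ψ : Fin p → H →L[ℝ] H) (ε Y : ℤ → Ω → H)
    (hFAR : AssumptionFAR P Ψ ε) (hY : IsStationaryCausalSolution P Ψ ε Y)
    (hΨ : ∃ k₀ : ℕ, 1 ≤ k₀ ∧ ‖(companion Ψ) ^ k₀‖ < 1)
    -- the state-space process, observed at the times `s, …, n`
    (X : ℤ → Ω → Hp p) (hX : ∀ k ω, X k ω = stateVector p (fun i => Y i ω) k) (s : ℤ)
    -- centring of the sample covariance: at the known mean zero, or at the sample mean
    (m : ℕ → Ω → Hp p)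
    (hm : (∀ n ω, m n ω = 0) ∨ (∀ n ω, m n ω = sampleMean (fun k => X k ω) s n))
    -- the leading `d` empirical eigenvalues and eigenvectors
    (d : ℕ) (lam : ℕ → Ω → Fin d → ℝ) (v : ℕ → Ω → Fin d → Hp p)
    (hv : ∀ n ω, IsLeadingEigensystem (sampleCov (m n ω) (fun k => X k ω) s n)
      (lam n ω) (v n ω))
    -- the least squares coefficient matrix
    (B : ℕ → Ω → Matrix (Fin d) (Fin d) ℝ)
    (hB : ∀ n ω, IsOLS (v n ω) (fun k => X k ω) s n (B n ω)) :
    IsBigOP P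
      (fun n ω =>
        ‖(varPredictor (v n ω) (fun k => X k ω) n (B n ω)) ⟨0, hp⟩
          - (bosqPredictor (lam n ω) (v n ω) (fun k => X k ω) s n) ⟨0, hp⟩‖)
      (fun n => 1 / (n : ℝ)) := by
  obtain rfl : X = fun k ω => stateVector p (fun i => Y i ω) k :=
    funext fun k => funext fun ω => hX k ω
  refine ((hY.isStationaryAR hFAR.innovation hΨ).isBigOP_varPredictor_sub_bosqPredictor s m hm d
    lam v hv B hB).mono fun n ω => ?_
  rw [abs_norm, abs_norm, ← PiLp.sub_apply]
  exact PiLp.norm_apply_le _ _
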